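/- Let $G=(V,E)$ be a connected undirected graph on $n$ vertices with non-negative edge weights, and let $r_1,\dots,r_k\in V$ ($k\ge 1$) be required vertices. (This is the singleton case: the $i$-th group is $R_i=\{r_i\}$.) A group Steiner path between $s$ and $t$ in a spanning subgraph $H$ of $G$ is a (not necessarily simple) path from $s$ to $t$ in $H$ that visits every $r_i$, in any order; its length is the sum of its edge weights, counted with multiplicity. The group Steiner distance $\sigma_H(s,t)$ is the minimum length of such a path ($+\infty$ if there is none). For $\alpha\ge 1$, a group Steiner $\alpha$-spanner of $G$ is a spanning subgraph $H$ of $G$ with $\sigma_H(s,t)\le\alpha\,\sigma_G(s,t)$ for all $s,t\in V$; its size is its number of edges. **Theorem.** There is an algorithm that, given $G$ with its edge weights, $r_1,\dots,r_k$ and $\varepsilon\in(0,1)$, computes a group Steiner $(1+\varepsilon)$-spanner of $G$ with $O(n/\varepsilon^2)$ edges in time $2^k\,k\cdot n^{O(1)}$. All hidden constants are absolute. Time is the number of steps of a random access machine with unit-cost arithmetic on words of $O(k+\log n)$ bits and unit-cost addition, subtraction, multiplication and comparison of real numbers (the weights and $\varepsilon$). -/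

import Mathlib

open scoped NNReal ENNReal

/-! ### Group Steiner paths, distances and spanners -/

namespace GroupSteiner

/-- The length of a walk: the sum of its edge weights, with multiplicity. -/
def walkLength {V : Type*} {G : SimpleGraph V} (w : Sym2 V → ℝ≥0) {s t : V} (p : G.Walk s t) : ℝ≥0 :=
  (p.edges.map w).sum

/-- A walk is a group Steiner path with respect to the groups `R i` if it contains
at least one vertex of every group. -/
def IsGroupSteinerPath {V ι : Type*} {G : SimpleGraph V} (R : ι → Set V) {s t : V}
    (p : G.Walk s t) : Prop :=
  ∀ i, ∃ v ∈ R i, v ∈ p.support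

/-- The group Steiner distance between `s` and `t` in `G` (it is `⊤` if and only if there is
no group Steiner path from `s` to `t`). -/
noncomputable def dist {V ι : Type*} (G : SimpleGraph V) (w : Sym2 V → ℝ≥0) (R : ι → Set V)
    (s t : V) : ℝ≥0∞ :=
  ⨅ (p : G.Walk s t) (_ : IsGroupSteinerPath R p), (walkLength w p : ℝ≥0∞)

/-- `H` is a group Steiner `α`-spanner of `G`: a spanning subgraph of `G` (the vertex set is the
whole of `V`) which preserves all group Steiner distances up to the factor `α`. -/
def IsSpanner {V ι : Type*} (G H : SimpleGraph V) (w : Sym2 V → ℝ≥0) (R : ι → Set V) (α : ℝ) : Prop :=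
  H ≤ G ∧ ∀ s t : V, dist H w R s t ≤ ENNReal.ofReal α * dist G w R s t

end GroupSteiner

/-! ### A random access machine with integer words and real registers

The machine has integer variables and integer arrays, whose entries are words (natural numbers
that do not exceed a bound `W`), and real variables and real arrays.  Programs are structured.
Every elementary operation (an arithmetic operation, a constant, a read, a write, a comparison, a
Boolean connective) takes one step.  There is no operation that turns a real into an integer. -/

namespace RealRAM

/-- A memory configuration: variables and arrays are named by natural numbers (a program
mentions only finitely many of them). -/
structure State where
  /-- integer variables -/
  nvar : ℕ → ℕ
  /-- integer arrays: array name, then index -/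
  narr : ℕ → ℕ → ℕ
  /-- real variables -/
  rvar : ℕ → ℝ
  /-- real arrays: array name, then index -/
  rarr : ℕ → ℕ → ℝ

/-- Integer expressions. -/
inductive NExp where
  | lit (c : ℕ)
  | var (x : ℕ)
  | get (a : ℕ) (i : NExp)
  | add (e f : NExp)
  | sub (e f : NExp)
  | mul (e f : NExp)
  | div (e f : NExp)
  | mod (e f : NExp)

/-- Real expressions. -/
inductive RExp where
  | lit (c : ℕ)
  | var (x : ℕ)
  | get (a : ℕ) (i : NExp)
  | add (e f : RExp)
  | sub (e f : RExp)
  | mul (e f : RExp)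

/-- Tests. -/
inductive BExp where
  | nle (e f : NExp)
  | rle (e f : RExp)
  | not (b : BExp)
  | and (b c : BExp)

/-- The value of an integer expression (subtraction is truncated). -/
def NExp.eval (s : State) : NExp → ℕ
  | .lit c => c
  | .var x => s.nvar x
  | .get a i => s.narr a (i.eval s)
  | .add e f => e.eval s + f.eval s
  | .sub e f => e.eval s - f.eval s
  | .mul e f => e.eval s * f.eval s
  | .div e f => e.eval s / f.eval s
  | .mod e f => e.eval s % f.eval s

/-- No overflow: the constants and the results of additions and multiplications that
occur in the evaluation do not exceed the largest word `W`.  (The other operations return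
values that are stored already, or at most as large as an operand.) -/
def NExp.Fits (W : ℕ) (s : State) : NExp → Prop
  | .lit c => c ≤ W
  | .var _ => True
  | .get _ i => i.Fits W s
  | .add e f => e.Fits W s ∧ f.Fits W s ∧ e.eval s + f.eval s ≤ W
  | .sub e f => e.Fits W s ∧ f.Fits W s
  | .mul e f => e.Fits W s ∧ f.Fits W s ∧ e.eval s * f.eval s ≤ W
  | .div e f => e.Fits W s ∧ f.Fits W s
  | .mod e f => e.Fits W s ∧ f.Fits W s

/-- The number of steps of the evaluation. -/
def NExp.cost : NExp → ℕ
  | .lit _ => 1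
  | .var _ => 1
  | .get _ i => i.cost + 1
  | .add e f => e.cost + f.cost + 1
  | .sub e f => e.cost + f.cost + 1
  | .mul e f => e.cost + f.cost + 1
  | .div e f => e.cost + f.cost + 1
  | .mod e f => e.cost + f.cost + 1

/-- The value of a real expression. -/
noncomputable def RExp.eval (s : State) : RExp → ℝ
  | .lit c => (c : ℝ)
  | .var x => s.rvar x
  | .get a i => s.rarr a (i.eval s)
  | .add e f => e.eval s + f.eval s
  | .sub e f => e.eval s - f.eval s
  | .mul e f => e.eval s * f.eval s

/-- No overflow in the array indices. -/
def RExp.Fits (W : ℕ) (s : State) : RExp → Prop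
  | .lit _ => True
  | .var _ => True
  | .get _ i => i.Fits W s
  | .add e f => e.Fits W s ∧ f.Fits W s
  | .sub e f => e.Fits W s ∧ f.Fits W s
  | .mul e f => e.Fits W s ∧ f.Fits W s

/-- The number of steps of the evaluation. -/
def RExp.cost : RExp → ℕ
  | .lit _ => 1
  | .var _ => 1
  | .get _ i => i.cost + 1
  | .add e f => e.cost + f.cost + 1
  | .sub e f => e.cost + f.cost + 1
  | .mul e f => e.cost + f.cost + 1

/-- The truth value of a test. -/
def BExp.eval (s : State) : BExp → Prop
  | .nle e f => e.eval s ≤ f.eval s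
  | .rle e f => e.eval s ≤ f.eval s
  | .not b => ¬ b.eval s
  | .and b c => b.eval s ∧ c.eval s

/-- No overflow in the evaluation of a test. -/
def BExp.Fits (W : ℕ) (s : State) : BExp → Prop
  | .nle e f => e.Fits W s ∧ f.Fits W s
  | .rle e f => e.Fits W s ∧ f.Fits W s
  | .not b => b.Fits W s
  | .and b c => b.Fits W s ∧ c.Fits W s

/-- The number of steps of the evaluation. -/
def BExp.cost : BExp → ℕ
  | .nle e f => e.cost + f.cost + 1
  | .rle e f => e.cost + f.cost + 1
  | .not b => b.cost + 1
  | .and b c => b.cost + c.cost + 1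

/-- Programs. -/
inductive Prog where
  | skip
  | nset (x : ℕ) (e : NExp)
  | nput (a : ℕ) (i e : NExp)
  | rset (x : ℕ) (e : RExp)
  | rput (a : ℕ) (i : NExp) (e : RExp)
  | seq (p q : Prog)
  | ite (b : BExp) (p q : Prog)
  | loop (b : BExp) (p : Prog)

/-- `Exec W p s T s'`: on a machine with largest word `W`, the program `p` started in the memory
configuration `s` halts after exactly `T` steps, without any overflow, in the configuration `s'`.
(`loop b p` is the while loop.) -/
inductive Exec (W : ℕ) : Prog → State → ℕ → State → Prop where
  | skip (s : State) : Exec W .skip s 1 s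
  | nset (x : ℕ) (e : NExp) (s : State) (h : e.Fits W s) :
      Exec W (.nset x e) s (e.cost + 1)
        { s with nvar := Function.update s.nvar x (e.eval s) }
  | nput (a : ℕ) (i e : NExp) (s : State) (hi : i.Fits W s) (h : e.Fits W s) :
      Exec W (.nput a i e) s (i.cost + e.cost + 1)
        { s with narr := Function.update s.narr a
                  (Function.update (s.narr a) (i.eval s) (e.eval s)) }
  | rset (x : ℕ) (e : RExp) (s : State) (h : e.Fits W s) :
      Exec W (.rset x e) s (e.cost + 1)
        { s with rvar := Function.update s.rvar x (e.eval s) }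
  | rput (a : ℕ) (i : NExp) (e : RExp) (s : State) (hi : i.Fits W s) (h : e.Fits W s) :
      Exec W (.rput a i e) s (i.cost + e.cost + 1)
        { s with rarr := Function.update s.rarr a
                  (Function.update (s.rarr a) (i.eval s) (e.eval s)) }
  | seq {p q : Prog} {s s' s'' : State} {T T' : ℕ} (hp : Exec W p s T s')
      (hq : Exec W q s' T' s'') : Exec W (.seq p q) s (T + T') s''
  | ite_true {b : BExp} {p q : Prog} {s s' : State} {T : ℕ} (hf : b.Fits W s) (hb : b.eval s)
      (hp : Exec W p s T s') : Exec W (.ite b p q) s (b.cost + T) s'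
  | ite_false {b : BExp} {p q : Prog} {s s' : State} {T : ℕ} (hf : b.Fits W s) (hb : ¬ b.eval s)
      (hq : Exec W q s T s') : Exec W (.ite b p q) s (b.cost + T) s'
  | loop_false {b : BExp} {p : Prog} {s : State} (hf : b.Fits W s) (hb : ¬ b.eval s) :
      Exec W (.loop b p) s b.cost s
  | loop_true {b : BExp} {p : Prog} {s s' s'' : State} {T T' : ℕ} (hf : b.Fits W s) (hb : b.eval s)
      (hp : Exec W p s T s') (hl : Exec W (.loop b p) s' T' s'') :
      Exec W (.loop b p) s (b.cost + T + T') s''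

/-! #### Input and output conventions -/

open Classical in
/-- Entry `j` of the adjacency matrix of `G`, stored row by row
(the entry of `(u, v)` has index `v + n * u`). -/
noncomputable def adjEntry {n : ℕ} (G : SimpleGraph (Fin n)) (j : ℕ) : ℕ :=
  if h : j < n * n then
    if G.Adj (finProdFinEquiv.symm ⟨j, h⟩).1 (finProdFinEquiv.symm ⟨j, h⟩).2 then 1 else 0
  else 0

open Classical in
/-- Entry `j` of the weight matrix of `G`, stored row by row (`0` for pairs that are not edges). -/
noncomputable def weightEntry {n : ℕ} (G : SimpleGraph (Fin n)) (w : Sym2 (Fin n) → ℝ≥0)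
    (j : ℕ) : ℝ :=
  if h : j < n * n then
    if G.Adj (finProdFinEquiv.symm ⟨j, h⟩).1 (finProdFinEquiv.symm ⟨j, h⟩).2 then
      (w s((finProdFinEquiv.symm ⟨j, h⟩).1, (finProdFinEquiv.symm ⟨j, h⟩).2) : ℝ)
    else 0
  else 0

/-- The initial memory for a weighted graph on `n` vertices, required vertices `r 0, …, r (k - 1)`
and a real parameter `ε`: integer variables `0` and `1` hold `n` and `k`, real variable `0` holds
`ε`, integer array `0` holds the adjacency matrix, integer array `1` the list of required
vertices, real array `0` the weight matrix.  Everything else is `0`. -/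
noncomputable def input {n k : ℕ} (G : SimpleGraph (Fin n)) (w : Sym2 (Fin n) → ℝ≥0)
    (r : Fin k → Fin n) (ε : ℝ) : State where
  nvar x := if x = 0 then n else if x = 1 then k else 0
  narr a j :=
    if a = 0 then adjEntry G j
    else if a = 1 then (if h : j < k then (r ⟨j, h⟩ : ℕ) else 0)
    else 0
  rvar x := if x = 0 then ε else 0
  rarr a j := if a = 0 then weightEntry G w j else 0

/-- The final memory holds the adjacency matrix of `H`, row by row, in integer array `2`. -/
def IsOutput {n : ℕ} (s : State) (H : SimpleGraph (Fin n)) : Prop :=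
  ∀ u v : Fin n, (s.narr 2 (v + n * u) = 1 ↔ H.Adj u v) ∧ (s.narr 2 (v + n * u) = 0 ↔ ¬ H.Adj u v)

end RealRAM

/-! Let `L` be the least group Steiner distance over all pairs of vertices. Choose greedily a net
`N` of terminals: any two net points are more than `ε L / 4` apart, and every terminal has a net
point within `ε L / 4`. A walk of length `L` through all terminals passes through all of `N`, so
`(|N| - 1) ε L / 4 ≤ L` and `|N| ≤ 5 / ε` (`card_separated_le`). The spanner consists of a shortest
path tree for every net point and a cheapest group Steiner path with at most `2 n` edges for every
ordered pair of net points: `O(n / ε) + O(n / ε²)` edges.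

For the stretch, cut a group Steiner path `p` from `s` to `t` at its first terminal `a` and its last
terminal `b`, and let `x`, `y` be net points near `a`, `b`. The spanner has shortest paths from `s`
to `x` and from `y` to `t`, and a cheapest group Steiner path from `x` to `y`. By the triangle
inequality their concatenation pays the detours `a x` and `b y` twice each, so its length is at most
`|p| + 4 ε L / 4 ≤ (1 + ε) |p|`, because `L ≤ |p|` (`markedGraph_isSpanner`).

Every walk can be replaced by one with at most `2 n` edges that visits the same vertices at no
greater cost (`exists_short_walk`). Indeed, fewer than `n` of its edges connect the visited
vertices; among more than `n` other edges, linear dependence over `ZMod 2` yields a nonempty part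
with all degrees even, and what remains after deleting it is again the edge multiset of a walk, by
Euler's theorem. Hence a dynamic program over source, hop bound up to `2 n`, subset of terminals and
vertex finds all the distances needed (`IsTable`); the empty subset gives ordinary distances.

Edges of weight zero make it delicate to read off a shortest path tree with one edge per vertex.
Each vertex contributes the edge chosen at the hop bound from which its distance is final
(`settleHop`); this hop bound drops strictly along the tree (`IsTable.exists_tree_walk`).

The program is verified with assertions that carry a step bound (`Halts`), with the rule
`Halts.forLoop` for loops. Filling the table dominates: `n (2 n + 1) 2 ^ k n` entries at `O(k n)`
steps each. -/

namespace GroupSteiner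

/-! ### Lengths of walks -/

section WalkLength

variable {V : Type*} {G : SimpleGraph V} (w : Sym2 V → ℝ≥0)

@[simp] lemma walkLength_nil (s : V) : walkLength w (.nil : G.Walk s s) = 0 := by
  simp [walkLength]

@[simp] lemma walkLength_cons {s u t : V} (h : G.Adj s u) (p : G.Walk u t) :
    walkLength w (.cons h p) = w s(s, u) + walkLength w p := by
  simp [walkLength]

@[simp] lemma walkLength_append {s u t : V} (p : G.Walk s u) (q : G.Walk u t) :
    walkLength w (p.append q) = walkLength w p + walkLength w q := by
  simp [walkLength]

@[simp] lemma walkLength_reverse {s t : V} (p : G.Walk s t) :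
    walkLength w p.reverse = walkLength w p := by
  simp [walkLength, List.sum_reverse]

/-- Only the multiset of edges matters for the length, so the Eulerian argument may delete and
reorder edges. -/
lemma walkLength_eq_sum {s t : V} (p : G.Walk s t) :
    walkLength w p = ((p.edges : Multiset (Sym2 V)).map w).sum := by
  simp [walkLength]

end WalkLength

/-! ### Eulerian multigraphs and short walks -/

section Euler

variable {V : Type*} [DecidableEq V] {G : SimpleGraph V}

/-- The boundary of an edge modulo two. -/
def boundary : Sym2 V → V → ZMod 2 :=
  Sym2.lift ⟨fun a b => Pi.single a 1 + Pi.single b 1, fun _ _ => add_comm _ _⟩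

@[simp] lemma boundary_mk (a b : V) : boundary s(a, b) = Pi.single a 1 + Pi.single b 1 := rfl

lemma pi_zmod_two_add_self {U : Type*} (x : U → ZMod 2) : x + x = 0 :=
  funext fun v => CharTwo.add_self_eq_zero (x v)

/-- The sum telescopes modulo two. This expresses the degree condition of Euler's theorem as one
equation in `V → ZMod 2`; for `s = t` it says that all degrees are even. -/
lemma sum_boundary_edges {s t : V} (p : G.Walk s t) :
    ((p.edges : Multiset (Sym2 V)).map boundary).sum = Pi.single s 1 + Pi.single t 1 := by
  induction p with
  | nil => simp [pi_zmod_two_add_self]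
  | @cons s u t h p ih =>
    simp only [SimpleGraph.Walk.edges_cons, ← Multiset.cons_coe, Multiset.map_cons,
      Multiset.sum_cons, ih, boundary_mk]
    have := pi_zmod_two_add_self (Pi.single u (1 : ZMod 2) : V → ZMod 2)
    linear_combination this

/-- A multiset of edges whose boundary is that of a walk from `s` to `t` contains such a walk. -/
lemma exists_walk_edges_le (t : V) (M : Multiset (Sym2 V)) :
    ∀ s : V, (∀ e ∈ M, e ∈ G.edgeSet) →
    (M.map boundary).sum = Pi.single s 1 + Pi.single t 1 →
    ∃ q : G.Walk s t, (q.edges : Multiset (Sym2 V)) ≤ M := by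
  induction M using Multiset.strongInductionOn with
  | ih M ih =>
    intro s hG hM
    by_cases hst : s = t
    · subst hst
      exact ⟨.nil, by simp⟩
    -- As `s ≠ t`, the vertex `s` has odd degree in `M`. The walk leaves along an edge of `M` at
    -- `s`, and the boundary condition moves to the other end.
    have h1 : ∃ e ∈ M, boundary e s ≠ 0 := by
      by_contra! hcon
      have h2 := congrArg (Pi.evalAddMonoidHom (fun _ : V => ZMod 2) s) hM
      rw [map_multiset_sum, Multiset.map_map, Multiset.map_congr rfl (f := _ ∘ _) (g := fun _ => 0) hcon] at h2
      simp [hst] at h2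
    obtain ⟨e, he, hes⟩ := h1
    obtain ⟨u, rfl⟩ : ∃ u, e = s(s, u) := by
      induction e using Sym2.ind with
      | _ a b =>
        by_cases ha : s = a
        · exact ⟨b, by rw [ha]⟩
        · by_cases hb : s = b
          · exact ⟨a, by rw [hb, Sym2.eq_swap]⟩
          · simp [ha, hb] at hes
    obtain ⟨M', rfl⟩ := Multiset.exists_cons_of_mem he
    have hadj : G.Adj s u := hG _ he
    obtain ⟨q, hq⟩ := ih M' (Multiset.lt_cons_self _ _) u
      (fun e he => hG e (Multiset.mem_cons_of_mem he)) (by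
        simp only [Multiset.map_cons, Multiset.sum_cons, boundary_mk] at hM
        have := pi_zmod_two_add_self (Pi.single u (1 : ZMod 2) : V → ZMod 2)
        linear_combination hM - this)
    exact ⟨.cons hadj q, by simpa [← Multiset.cons_coe] using hq⟩

/-- Euler's theorem: a connected multiset of edges with the boundary of a walk
is the multiset of edges of a walk. -/
theorem exists_walk_edges_eq [Finite V] {s t : V} (M : Multiset (Sym2 V))
    (hG : ∀ e ∈ M, e ∈ G.edgeSet)
    (hM : (M.map boundary).sum = Pi.single s 1 + Pi.single t 1)
    (hc : ∀ a b, s(a, b) ∈ M → ∃ q : G.Walk s a, ∀ e ∈ q.edges, e ∈ M) :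
    ∃ q : G.Walk s t, (q.edges : Multiset (Sym2 V)) = M := by
  -- `d` bounds the number of edges of `M` that the current walk still misses.
  have key : ∀ d : ℕ, ∀ q : G.Walk s t, (q.edges : Multiset (Sym2 V)) ≤ M →
      M.card ≤ q.length + d → ∃ q : G.Walk s t, (q.edges : Multiset (Sym2 V)) = M := by
    intro d
    induction d with
    | zero =>
      intro q hq hd
      exact ⟨q, Multiset.eq_of_le_of_card_le hq (by simpa using hd)⟩
    | succ d ih =>
      intro q hq hd
      obtain ⟨R, hR⟩ := Multiset.le_iff_exists_add.1 hq
      by_cases hR0 : R = 0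
      · exact ⟨q, by rw [hR, hR0, add_zero]⟩
      -- Some unused edge touches the walk. If an unused edge has its end `a` off the walk, the
      -- connection from `s` to `a` leaves the support of `q` along an edge of `M`, which is unused
      -- since its far end is not on `q`.
      obtain ⟨x, hx, y, hxy⟩ : ∃ x ∈ q.support, ∃ y, s(x, y) ∈ R := by
        obtain ⟨e, he⟩ := Multiset.exists_mem_of_ne_zero hR0
        induction e using Sym2.ind with
        | _ a b =>
          by_cases ha : a ∈ q.support
          · exact ⟨a, ha, b, he⟩
          obtain ⟨p, hp⟩ := hc a b (by rw [hR]; exact Multiset.mem_add.2 (Or.inr he))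
          obtain ⟨d, hd, h1, h2⟩ :=
            p.exists_boundary_dart {z | z ∈ q.support} q.start_mem_support ha
          refine ⟨d.fst, h1, d.snd, ?_⟩
          have h3 : s(d.fst, d.snd) ∈ M :=
            hp _ (List.mem_map.2 ⟨d, hd, rfl⟩)
          rw [hR, Multiset.mem_add] at h3
          exact h3.resolve_left fun h4 => h2 (q.snd_mem_support_of_mem_edges h4)
      obtain ⟨R', rfl⟩ := Multiset.exists_cons_of_mem hxy
      have hadj : G.Adj x y :=
        hG s(x, y) (by rw [hR]; exact Multiset.mem_add.2 (Or.inr hxy))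
      -- The unused edges have zero boundary, so without `s(x, y)` they contain a walk from `y` back
      -- to `x`. The closed walk obtained is spliced into `q` at `x`.
      obtain ⟨c, hcR⟩ := exists_walk_edges_le (G := G) x R' y
        (fun e he => hG e (by
          rw [hR]; exact Multiset.mem_add.2 (Or.inr (Multiset.mem_cons_of_mem he)))) (by
          rw [hR, Multiset.map_add, Multiset.sum_add, sum_boundary_edges] at hM
          simp only [Multiset.map_cons, Multiset.sum_cons, boundary_mk] at hM
          have h1 := pi_zmod_two_add_self (Pi.single x (1 : ZMod 2) : V → ZMod 2)
          have h2 := pi_zmod_two_add_self (Pi.single y (1 : ZMod 2) : V → ZMod 2)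
          linear_combination hM - h1 - h2)
      obtain ⟨p₁, p₂, rfl⟩ := SimpleGraph.Walk.mem_support_iff_exists_append.1 hx
      refine ih (p₁.append (.cons hadj (c.append p₂))) ?_ ?_
      · rw [hR]
        obtain ⟨R'', rfl⟩ := Multiset.le_iff_exists_add.1 hcR
        refine Multiset.le_iff_exists_add.2 ⟨R'', ?_⟩
        simp only [SimpleGraph.Walk.edges_append, SimpleGraph.Walk.edges_cons,
          ← Multiset.coe_add, ← Multiset.cons_coe, ← Multiset.singleton_add]
        abel
      · simp only [SimpleGraph.Walk.length_append, SimpleGraph.Walk.length_cons] at hd ⊢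
        omega
  obtain ⟨q, hq⟩ := exists_walk_edges_le t M s hG hM
  exact key M.card q hq (by omega)

/-- A multiset of edges with more elements than there are vertices contains a nonempty
submultiset without boundary. -/
lemma exists_boundaryless [Fintype V] (R : Multiset (Sym2 V)) (hR : Fintype.card V < R.card) :
    ∃ C ≤ R, C ≠ 0 ∧ (C.map boundary).sum = 0 := by
  induction R using Quotient.inductionOn with
  | _ l =>
    simp only [Multiset.quot_mk_to_coe, Multiset.coe_card] at hR ⊢
    -- More vectors than the dimension of `V → ZMod 2`. The indices with nonzero coefficient in a
    -- linear relation give the submultiset, since such a coefficient is `1`.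
    have h1 : ¬ LinearIndependent (ZMod 2) (fun i : Fin l.length => boundary (l.get i)) := by
      intro h
      have := h.fintype_card_le_finrank
      simp at this
      omega
    obtain ⟨g, hg, i, hi⟩ := Fintype.not_linearIndependent_iff.1 h1
    refine ⟨(Finset.univ.filter fun i => g i ≠ 0).val.map l.get, ?_, ?_, ?_⟩
    · calc _ ≤ (Finset.univ : Finset (Fin l.length)).val.map l.get :=
            Multiset.map_le_map (Finset.val_le_iff.2 (Finset.filter_subset _ _))
        _ = l := by simp
    · intro h
      rw [Multiset.map_eq_zero, Finset.val_eq_zero] at h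
      have : i ∈ Finset.univ.filter fun i => g i ≠ 0 := by simp [hi]
      simp [h] at this
    · rw [Multiset.map_map]
      change ∑ i ∈ Finset.univ.filter fun i => g i ≠ 0, boundary (l.get i) = 0
      rw [← hg, Finset.sum_filter]
      refine Finset.sum_congr rfl fun i _ => ?_
      have h2 : ∀ a : ZMod 2, a = 0 ∨ a = 1 := by decide
      rcases h2 (g i) with h | h <;> simp [h]

/-- The vertices of a walk are connected by few of its edges. -/
lemma exists_spanning_edges [Fintype V] {s t : V} (p : G.Walk s t) :
    ∃ F : Multiset (Sym2 V), F ≤ p.edges ∧ F.card < p.support.toFinset.card ∧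
      ∀ v ∈ p.support, ∃ q : G.Walk s v, ∀ e ∈ q.edges, e ∈ F := by
  induction p with
  | @nil s => exact ⟨0, by simp, by simp, fun v hv => by
      obtain rfl : v = s := by simpa using hv
      exact ⟨.nil, by simp⟩⟩
  | @cons s u t h p ih =>
    obtain ⟨F, hF, hcard, hq⟩ := ih
    -- The edge is kept only if its start is not visited again later, so each kept edge accounts for
    -- one new vertex.
    by_cases hs : s ∈ p.support
    · refine ⟨F, ?_, ?_, fun v hv => ?_⟩
      · rw [SimpleGraph.Walk.edges_cons, ← Multiset.cons_coe]
        exact hF.trans (Multiset.le_cons_self _ _)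
      · simpa [hs] using hcard
      · obtain ⟨q₁, h₁⟩ := hq s hs
        obtain ⟨q₂, h₂⟩ := hq v (by
          rcases List.mem_cons.1 (by simpa using hv) with rfl | h
          exacts [hs, h])
        refine ⟨q₁.reverse.append q₂, fun e he => ?_⟩
        simp only [SimpleGraph.Walk.edges_append, SimpleGraph.Walk.edges_reverse,
          List.mem_append, List.mem_reverse] at he
        exact he.elim (h₁ e) (h₂ e)
    · refine ⟨s(s, u) ::ₘ F, ?_, ?_, fun v hv => ?_⟩
      · rw [SimpleGraph.Walk.edges_cons, ← Multiset.cons_coe]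
        exact (Multiset.cons_le_cons_iff _).2 hF
      · simp only [SimpleGraph.Walk.support_cons, List.toFinset_cons, Multiset.card_cons]
        rw [Finset.card_insert_of_notMem (by simpa using hs)]
        omega
      · rcases List.mem_cons.1 (by simpa using hv) with rfl | hv
        · exact ⟨.nil, by simp⟩
        · obtain ⟨q, hq⟩ := hq v hv
          refine ⟨.cons h q, fun e he => ?_⟩
          rcases List.mem_cons.1 (by simpa using he) with rfl | he
          exacts [Multiset.mem_cons_self _ _, Multiset.mem_cons_of_mem (hq e he)]

/-- Every walk can be replaced by one of linear length that visits the same vertices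
and is not more expensive. -/
theorem exists_short_walk [Fintype V] (w : Sym2 V → ℝ≥0) {s t : V} (p : G.Walk s t) :
    ∃ q : G.Walk s t, q.length ≤ 2 * Fintype.card V ∧ walkLength w q ≤ walkLength w p ∧
      ∀ v ∈ p.support, v ∈ q.support := by
  induction hn : p.length using Nat.strong_induction_on generalizing p with
  | _ m ih =>
    by_cases hm : p.length ≤ 2 * Fintype.card V
    · exact ⟨p, hm, le_rfl, fun _ => id⟩
    -- `F` is never touched. With more than `2 n` edges in `p`, more than `n` are left for `R`, and
    -- a boundaryless part `C` of `R` can be removed: `F + R'` keeps the boundary, and `F` keeps it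
    -- connected.
    obtain ⟨F, hF, hcard, hconn⟩ := exists_spanning_edges p
    obtain ⟨R, hR⟩ := Multiset.le_iff_exists_add.1 hF
    have hcard' : F.card ≤ Fintype.card V := hcard.le.trans (Finset.card_le_univ _)
    have h1 : p.length = F.card + R.card := by
      rw [← Multiset.card_add, ← hR]; simp
    obtain ⟨C, hC, hC0, hCb⟩ := exists_boundaryless R (by omega)
    obtain ⟨R', rfl⟩ := Multiset.le_iff_exists_add.1 hC
    have hle : F + R' ≤ (p.edges : Multiset (Sym2 V)) := by
      rw [hR]; exact add_le_add le_rfl (Multiset.le_add_left _ _)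
    have hconn' : ∀ v ∈ p.support, ∃ q : G.Walk s v, ∀ e ∈ q.edges, e ∈ F + R' := by
      intro v hv
      obtain ⟨q, hq⟩ := hconn v hv
      exact ⟨q, fun e he => Multiset.mem_add.2 (Or.inl (hq e he))⟩
    obtain ⟨q, hq⟩ := exists_walk_edges_eq (G := G) (s := s) (t := t) (F + R')
      (fun e he => p.edges_subset_edgeSet (Multiset.mem_of_le hle he)) (by
        rw [← sum_boundary_edges p, hR]
        simp only [Multiset.map_add, Multiset.sum_add, hCb, zero_add])
      (fun a b hab => hconn' a
        (p.fst_mem_support_of_mem_edges (Multiset.mem_of_le hle hab)))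
    have hsup : ∀ v ∈ p.support, v ∈ q.support := by
      intro v hv
      obtain ⟨q', hq'⟩ := hconn' v hv
      -- A vertex other than `s` is an end of the last edge of its connection, and that edge belongs
      -- to `F + R'`, the edges of `q`.
      cases hrev : q'.reverse with
      | nil => exact q.start_mem_support
      | @cons _ u _ h q'' =>
        refine q.fst_mem_support_of_mem_edges (u := u) ?_
        rw [← Multiset.mem_coe, hq]
        refine hq' _ ?_
        rw [← List.mem_reverse, ← SimpleGraph.Walk.edges_reverse, hrev]
        simp
    have hlen : q.length = F.card + R'.card := by
      rw [← Multiset.card_add, ← hq]; simp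
    have hCpos : 0 < C.card := Multiset.card_pos.2 hC0
    rw [Multiset.card_add] at h1
    obtain ⟨q₂, h2, h3, h4⟩ := ih q.length (by omega) q rfl
    refine ⟨q₂, h2, h3.trans ?_, fun v hv => h4 v (hsup v hv)⟩
    rw [walkLength_eq_sum, walkLength_eq_sum, hq, hR]
    simp only [Multiset.map_add, Multiset.sum_add]
    exact add_le_add le_rfl le_add_self

end Euler

/-! ### Separated vertices on a walk, and splitting at terminals -/

section Terminals

variable {V : Type*} {G : SimpleGraph V} (w : Sym2 V → ℝ≥0)

/-- A walk through pairwise distant vertices is long. -/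
lemma separated_walk_aux [DecidableEq V] {δ : ℝ} {s t : V} (p : G.Walk s t) :
    ∀ N : Finset V, N.Nonempty → (∀ v ∈ N, v ∈ p.support) →
      (∀ a ∈ N, ∀ b ∈ N, a ≠ b → ∀ q : G.Walk a b, δ ≤ walkLength w q) →
      ∃ a ∈ N, ∃ q : G.Walk s a,
        (walkLength w q : ℝ) + (N.card - 1) * δ ≤ walkLength w p := by
  induction p with
  | @nil s =>
    intro N hN hsub hsep
    have hNs : N = {s} := Finset.eq_singleton_iff_nonempty_unique_mem.2
      ⟨hN, fun x hx => by simpa using hsub x hx⟩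
    exact ⟨s, by simp [hNs], .nil, by simp [hNs]⟩
  | @cons s u t h p ih =>
    intro N hN hsub hsep
    by_cases hs : s ∈ N
    · refine ⟨s, hs, .nil, ?_⟩
      by_cases hN' : (N.erase s).Nonempty
      · obtain ⟨a, ha, q, hq⟩ := ih (N.erase s) hN' (fun v hv => by
          have h1 := hsub v (Finset.mem_of_mem_erase hv)
          rcases List.mem_cons.1 (by simpa using h1) with rfl | h2
          · simp at hv
          · exact h2) (fun a ha b hb => hsep a (Finset.mem_of_mem_erase ha) b
            (Finset.mem_of_mem_erase hb))
        -- The induction hypothesis provides a walk from `u` to another member of `N`. Prolonged to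
        -- `s` it joins two members, which pays for one more `δ`.
        have h1 := hsep s hs a (Finset.mem_of_mem_erase ha) (Finset.ne_of_mem_erase ha).symm
          (.cons h q)
        have h2 : ((N.erase s).card : ℝ) = N.card - 1 := by
          rw [Finset.card_erase_of_mem hs, Nat.cast_sub (Finset.card_pos.2 hN), Nat.cast_one]
        rw [h2] at hq
        simp only [walkLength_cons, walkLength_nil, NNReal.coe_add, NNReal.coe_zero] at h1 ⊢
        nlinarith
      · have : N.card = 1 := by
          rw [Finset.not_nonempty_iff_eq_empty] at hN'
          have := Finset.card_erase_of_mem hs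
          rw [hN', Finset.card_empty] at this
          have := Finset.card_pos.2 hN
          omega
        simp [this]
        positivity
    · obtain ⟨a, ha, q, hq⟩ := ih N hN (fun v hv => by
          rcases List.mem_cons.1 (by simpa using hsub v hv) with rfl | h2
          · exact absurd hv hs
          · exact h2) hsep
      refine ⟨a, ha, .cons h q, ?_⟩
      simp only [walkLength_cons, NNReal.coe_add]
      linarith

lemma separated_walk [DecidableEq V] {δ : ℝ} {s t : V} (p : G.Walk s t) (N : Finset V)
    (hN : N.Nonempty) (hsub : ∀ v ∈ N, v ∈ p.support)
    (hsep : ∀ a ∈ N, ∀ b ∈ N, a ≠ b → ∀ q : G.Walk a b, δ ≤ walkLength w q) :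
    (N.card - 1) * δ ≤ walkLength w p := by
  obtain ⟨a, -, q, hq⟩ := separated_walk_aux w p N hN hsub hsep
  have : (0 : ℝ) ≤ walkLength w q := NNReal.coe_nonneg _
  linarith

/-- The number of pairwise distant vertices on a walk, relative to its length. -/
lemma card_separated_le [DecidableEq V] {ε : ℝ} (hε : 0 < ε) (hε1 : ε < 1) {s t : V}
    (p : G.Walk s t) (N : Finset V) (hsub : ∀ v ∈ N, v ∈ p.support)
    (hsep : ∀ a ∈ N, ∀ b ∈ N, a ≠ b → ∀ q : G.Walk a b,
      ε * walkLength w p < 4 * walkLength w q) :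
    (N.card : ℝ) ≤ 5 / ε := by
  rcases N.eq_empty_or_nonempty with rfl | hN
  · simp; positivity
  rw [le_div_iff₀ hε]
  -- If `p` has length `0`, the counting bound is void; but two members of `N` would be joined by a
  -- part of `p` of length `0`, against the strict separation, so `N` has at most one point.
  rcases eq_or_ne (walkLength w p) 0 with h0 | h0
  · have h1 : N.card ≤ 1 := by
      rw [Finset.card_le_one]
      intro a ha b hb
      by_contra hab
      obtain ⟨p₁, p₂, rfl⟩ := SimpleGraph.Walk.mem_support_iff_exists_append.1 (hsub a ha)
      have h2 : ∃ q : G.Walk a b, walkLength w q = 0 := by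
        simp only [walkLength_append, add_eq_zero] at h0
        rcases SimpleGraph.Walk.mem_support_append_iff _ _|>.1 (hsub b hb) with hb' | hb'
        · obtain ⟨q₁, q₂, rfl⟩ := SimpleGraph.Walk.mem_support_iff_exists_append.1 hb'
          simp only [walkLength_append, add_eq_zero] at h0
          exact ⟨q₂.reverse, by simp [h0]⟩
        · obtain ⟨q₁, q₂, rfl⟩ := SimpleGraph.Walk.mem_support_iff_exists_append.1 hb'
          simp only [walkLength_append, add_eq_zero] at h0
          exact ⟨q₁, by simp [h0]⟩
      obtain ⟨q, hq⟩ := h2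
      have := hsep a ha b hb hab q
      simp [h0, hq] at this
    have h2 : (N.card : ℝ) ≤ 1 := by exact_mod_cast h1
    nlinarith
  · have hpos : (0 : ℝ) < walkLength w p := by
      exact_mod_cast pos_iff_ne_zero.2 h0
    -- This gives `card N ≤ 4 / ε + 1`, and `1 < 1 / ε`.
    have := separated_walk w (δ := ε * walkLength w p / 4) p N hN hsub
      (fun a ha b hb hab q => by linarith [hsep a ha b hb hab q])
    have h3 : ((N.card : ℝ) - 1) * ε ≤ 4 := by
      by_contra! h
      nlinarith
    linarith

/-- Splitting a walk at its first vertex with a given property. -/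
lemma exists_split_first (Q : V → Prop) {s t : V} (p : G.Walk s t)
    (h : ∃ v ∈ p.support, Q v) :
    ∃ a, Q a ∧ ∃ (q₁ : G.Walk s a) (q₂ : G.Walk a t),
      walkLength w p = walkLength w q₁ + walkLength w q₂ ∧
      ∀ v ∈ p.support, Q v → v ∈ q₂.support := by
  induction p with
  | @nil s =>
    obtain ⟨v, hv, hQ⟩ := h
    obtain rfl : v = s := by simpa using hv
    exact ⟨v, hQ, .nil, .nil, by simp, fun v hv _ => hv⟩
  | @cons s u t hsu p ih =>
    by_cases hs : Q s
    · exact ⟨s, hs, .nil, .cons hsu p, by simp, fun v hv _ => hv⟩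
    · have h1 : ∀ v ∈ (SimpleGraph.Walk.cons hsu p).support, Q v → v ∈ p.support := by
        intro v hv hQ
        rcases List.mem_cons.1 (by simpa using hv) with rfl | h2
        exacts [absurd hQ hs, h2]
      obtain ⟨v, hv, hQ⟩ := h
      obtain ⟨a, ha, q₁, q₂, h2, h3⟩ := ih ⟨v, h1 v hv hQ, hQ⟩
      exact ⟨a, ha, .cons hsu q₁, q₂, by simp [h2, add_assoc],
        fun v hv hQ => h3 v (h1 v hv hQ) hQ⟩

/-- Splitting a walk at its first and its last vertex with a given property. -/
lemma exists_split_first_last (Q : V → Prop) {s t : V} (p : G.Walk s t)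
    (h : ∃ v ∈ p.support, Q v) :
    ∃ a b, Q a ∧ Q b ∧ ∃ (q₁ : G.Walk s a) (q₂ : G.Walk a b) (q₃ : G.Walk b t),
      walkLength w p = walkLength w q₁ + walkLength w q₂ + walkLength w q₃ ∧
      ∀ v ∈ p.support, Q v → v ∈ q₂.support := by
  obtain ⟨v, hv, hQ⟩ := h
  obtain ⟨a, ha, q₁, q, h1, h2⟩ := exists_split_first w Q p ⟨v, hv, hQ⟩
  obtain ⟨b, hb, q₃, q₂, h3, h4⟩ := exists_split_first w Q q.reverse
    ⟨v, by simpa using h2 v hv hQ, hQ⟩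
  refine ⟨a, b, ha, hb, q₁, q₂.reverse, q₃.reverse, ?_, fun v hv hQ => ?_⟩
  · rw [walkLength_reverse] at h3
    rw [h1, h3, walkLength_reverse, walkLength_reverse]
    ring
  · simpa using h4 v (by simpa using h2 v hv hQ) hQ

end Terminals

end GroupSteiner

/-! ### The dynamic program -/

namespace GroupSteiner

/-- The part of the bit mask `m` (of the indices below `i`) that is not located at `v`. -/
def clearMask (ρ : ℕ → ℕ) (v m : ℕ) : ℕ → ℕ
  | 0 => 0
  | i + 1 => clearMask ρ v m i + if m.testBit i ∧ ρ i ≠ v then 2 ^ i else 0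

lemma clearMask_lt (ρ : ℕ → ℕ) (v m i : ℕ) : clearMask ρ v m i < 2 ^ i := by
  induction i with
  | zero => simp [clearMask]
  | succ i ih =>
    rw [clearMask, pow_succ]
    split_ifs <;> omega

/-- The partial result is below `2 ^ i`, so adding `2 ^ i` sets bit `i` without a carry. -/
lemma testBit_clearMask (ρ : ℕ → ℕ) (v m i j : ℕ) :
    (clearMask ρ v m i).testBit j = true ↔ j < i ∧ m.testBit j = true ∧ ρ j ≠ v := by
  induction i generalizing j with
  | zero => simp [clearMask]
  | succ i ih =>
    have hlt := clearMask_lt ρ v m i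
    rw [clearMask]
    rcases lt_trichotomy j i with hj | rfl | hj
    · have h1 : (clearMask ρ v m i + if m.testBit i ∧ ρ i ≠ v then 2 ^ i else 0).testBit j
          = (clearMask ρ v m i).testBit j := by
        split_ifs
        · rw [add_comm, Nat.testBit_two_pow_add_gt hj]
        · rfl
      rw [h1, ih]
      simp [hj, hj.trans (Nat.lt_succ_self i)]
    · have h0 : (clearMask ρ v m j).testBit j = false := Nat.testBit_lt_two_pow hlt
      split_ifs with h
      · rw [add_comm, Nat.testBit_two_pow_add_eq, h0]
        simp [h]
      · rw [add_zero, h0]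
        simp only [Bool.false_eq_true, false_iff]
        exact fun h' => h h'.2
    · have h1 : (clearMask ρ v m i + if m.testBit i ∧ ρ i ≠ v then 2 ^ i else 0) < 2 ^ j :=
        (clearMask_lt ρ v m (i + 1)).trans_le (Nat.pow_le_pow_right (by norm_num) hj)
      rw [Nat.testBit_lt_two_pow h1]
      simp only [Bool.false_eq_true, false_iff]
      omega

lemma clearMask_zero (ρ : ℕ → ℕ) (v i : ℕ) : clearMask ρ v 0 i = 0 := by
  induction i with
  | zero => rfl
  | succ i ih => simp [clearMask, ih]

/-- The index of the table entry for source `s`, hop bound `h`, bit mask `m` and vertex `v`. -/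
def tableIndex (n k s h m v : ℕ) : ℕ := ((s * (2 * n + 1) + h) * 2 ^ k + m) * n + v

/-- A pointer is a bare table index; its remainder modulo `n` is the vertex, which is all that
marking an edge requires. -/
lemma tableIndex_mod (n k s h m : ℕ) {v : ℕ} (hv : v < n) : tableIndex n k s h m v % n = v := by
  rw [tableIndex, Nat.mul_add_mod', Nat.mod_eq_of_lt hv]

variable {n k : ℕ}

lemma weightEntry_eq (G : SimpleGraph (Fin n)) [DecidableRel G.Adj] (w : Sym2 (Fin n) → ℝ≥0)
    (u v : Fin n) : RealRAM.weightEntry G w (v + n * u) = if G.Adj u v then (w s(u, v) : ℝ) else 0 := by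
  have h : (v : ℕ) + n * u < n * n := (finProdFinEquiv (u, v)).isLt
  have h1 : finProdFinEquiv.symm ⟨(v : ℕ) + n * u, h⟩ = (u, v) :=
    (Equiv.symm_apply_eq _).2 rfl
  rw [RealRAM.weightEntry, dif_pos h, h1]
  congr

lemma weightEntry_nonneg (G : SimpleGraph (Fin n)) (w : Sym2 (Fin n) → ℝ≥0) (j : ℕ) :
    0 ≤ RealRAM.weightEntry G w j := by
  unfold RealRAM.weightEntry
  split_ifs <;> simp

/-- The arrays `D` (values) and `P` (pointers) solve the dynamic program for the cheapest walks
with at most `2 n` edges from a vertex to a source that visit a prescribed set of terminals. -/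
structure IsTable (G : SimpleGraph (Fin n)) (w : Sym2 (Fin n) → ℝ≥0) (k : ℕ) (ρ : ℕ → ℕ)
    (big : ℝ) (D : ℕ → ℝ) (P : ℕ → ℕ) : Prop where
  init : ∀ s v : Fin n, ∀ m < 2 ^ k, D (tableIndex n k s 0 m v) =
    if clearMask ρ v m k = 0 ∧ v = s then 0 else big
  -- The case `u = v` lets a walk stay in place for free, so an entry stands for at most `h` edges
  -- rather than exactly `h`.
  step : ∀ s v : Fin n, ∀ h < 2 * n, ∀ m < 2 ^ k, ∃ u : Fin n, (u = v ∨ G.Adj u v) ∧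
    P (tableIndex n k s (h + 1) m v) = tableIndex n k s h (clearMask ρ v m k) u ∧
    D (tableIndex n k s (h + 1) m v) =
      D (tableIndex n k s h (clearMask ρ v m k) u) + RealRAM.weightEntry G w (v + n * u)
  opt : ∀ s v : Fin n, ∀ h < 2 * n, ∀ m < 2 ^ k, ∀ u : Fin n, (u = v ∨ G.Adj u v) →
    D (tableIndex n k s (h + 1) m v) ≤
      D (tableIndex n k s h (clearMask ρ v m k) u) + RealRAM.weightEntry G w (v + n * u)

/-- `p` visits all terminals in the bit mask `m`. -/
def Covers (r : Fin k → Fin n) {H : SimpleGraph (Fin n)} {u v : Fin n} (m : ℕ) (p : H.Walk u v) :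
    Prop :=
  ∀ i : Fin k, m.testBit i = true → r i ∈ p.support

/-- The edge from the vertex of a table entry to the vertex of the entry it points to. -/
def entryEdge (n : ℕ) (P : ℕ → ℕ) (x : ℕ) : Sym2 ℕ := s(x % n, P x % n)

/-- `i` is the least number such that `f j ≤ c` for all `j` from `i` to `N - 1`. -/
noncomputable def settle (f : ℕ → ℝ) (c : ℝ) : ℕ → ℕ
  | 0 => 0
  | i + 1 => if f i ≤ c then settle f c i else i + 1

lemma settle_le (f : ℕ → ℝ) (c : ℝ) (N : ℕ) : settle f c N ≤ N := by
  induction N with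
  | zero => rfl
  | succ N ih => rw [settle]; split_ifs <;> omega

lemma le_of_settle_le (f : ℕ → ℝ) (c : ℝ) {N h : ℕ} (h1 : settle f c N ≤ h) (h2 : h < N) :
    f h ≤ c := by
  induction N with
  | zero => omega
  | succ N ih =>
    rw [settle] at h1
    split_ifs at h1 with hf
    · rcases Nat.lt_succ_iff_lt_or_eq.1 h2 with h3 | rfl
      exacts [ih h1 h3, hf]
    · omega

/-- By minimality, the value just before a positive settling point is too large. -/
lemma lt_of_settle_eq (f : ℕ → ℝ) (c : ℝ) {N h : ℕ} (h1 : settle f c N = h + 1) : c < f h := by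
  induction N with
  | zero => simp [settle] at h1
  | succ N ih =>
    rw [settle] at h1
    split_ifs at h1 with hf
    · exact ih h1
    · obtain rfl : N = h := by omega
      exact not_le.1 hf

namespace IsTable

variable {G : SimpleGraph (Fin n)} {w : Sym2 (Fin n) → ℝ≥0} {ρ : ℕ → ℕ} {r : Fin k → Fin n}
  {big : ℝ} {D : ℕ → ℝ} {P : ℕ → ℕ}

lemma weightEntry_self (G : SimpleGraph (Fin n)) (w : Sym2 (Fin n) → ℝ≥0) (v : Fin n) :
    RealRAM.weightEntry G w (v + n * v) = 0 := by
  classical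
  simp [weightEntry_eq]

lemma weightEntry_adj {u v : Fin n} (h : G.Adj u v) :
    RealRAM.weightEntry G w (v + n * u) = w s(u, v) := by
  classical
  simp [weightEntry_eq, h]

/-- No walk with few edges is cheaper than the table entry. -/
lemma le_walkLength (T : IsTable G w k ρ big D P) (hρ : ∀ i : Fin k, ρ i = r i) {s v : Fin n}
    {h m : ℕ} (p : G.Walk v s) (hp : p.length ≤ h) (hh : h ≤ 2 * n) (hm : m < 2 ^ k)
    (hc : Covers r m p) : D (tableIndex n k s h m v) ≤ walkLength w p := by
  induction h generalizing v m with
  | zero =>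
    cases p with
    | nil =>
      have h0 : clearMask ρ s m k = 0 := by
        refine Nat.eq_of_testBit_eq fun i => ?_
        rw [Nat.zero_testBit, Bool.eq_false_iff]
        intro h
        obtain ⟨hi, hb, hne⟩ := (testBit_clearMask _ _ _ _ _).1 h
        have := hc ⟨i, hi⟩ hb
        simp only [SimpleGraph.Walk.support_nil, List.mem_singleton] at this
        exact hne (by rw [← this]; exact hρ ⟨i, hi⟩)
      rw [T.init s s m hm, if_pos ⟨h0, rfl⟩]
      simp
    | cons _ _ => simp at hp
  | succ h ih =>
    have hcl := clearMask_lt ρ v m k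
    cases p with
    | nil =>
      have h1 := T.opt s s h (by omega) m hm s (Or.inl rfl)
      rw [weightEntry_self, add_zero] at h1
      refine h1.trans (ih .nil (by simp) (by omega) hcl fun i hi => ?_)
      exact hc i ((testBit_clearMask _ _ _ _ _).1 hi).2.1
    | @cons _ u _ hvu p =>
      have h1 := T.opt s v h (by omega) m hm u (Or.inr hvu.symm)
      rw [weightEntry_adj hvu.symm] at h1
      have h2 := ih p (by simpa using hp) (by omega) hcl fun i hi => by
        obtain ⟨hi, hb, hne⟩ := (testBit_clearMask _ _ _ _ _).1 hi
        have h3 := hc i hb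
        rcases List.mem_cons.1 (by simpa using h3) with h4 | h4
        · exact absurd (by rw [hρ, h4]) hne
        · exact h4
      rw [walkLength_cons, Sym2.eq_swap]
      push_cast
      linarith

/-- A table entry below `big` is the cost of the walk described by the pointers. -/
lemma exists_walk (T : IsTable G w k ρ big D P) (hρ : ∀ i : Fin k, ρ i = r i)
    (H : SimpleGraph (Fin n)) {s v : Fin n}
    {h m : ℕ} (hh : h ≤ 2 * n) (hm : m < 2 ^ k)
    (hD : D (tableIndex n k s h m v) < big)
    (hH : ∀ i < h, ∀ a b : Fin n,
      s((a : ℕ), (b : ℕ)) = entryEdge n P (P^[i] (tableIndex n k s h m v)) →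
      G.Adj a b → H.Adj a b) :
    ∃ p : H.Walk v s, (walkLength w p : ℝ) = D (tableIndex n k s h m v) ∧ Covers r m p := by
  induction h generalizing v m with
  | zero =>
    have h1 := T.init s v m hm
    split_ifs at h1 with hc
    · obtain ⟨hc, rfl⟩ := hc
      refine ⟨.nil, by simp [h1], fun i hi => ?_⟩
      by_contra hne
      simp only [SimpleGraph.Walk.support_nil, List.mem_singleton] at hne
      have h2 := (testBit_clearMask ρ v m k i).2 ⟨i.isLt, hi, by
        rw [hρ]; exact fun h => hne (Fin.ext h)⟩
      simp [hc] at h2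
    · exact absurd hD (by rw [h1]; exact lt_irrefl _)
  | succ h ih =>
    have hcl := clearMask_lt ρ v m k
    obtain ⟨u, huv, hP, hDe⟩ := T.step s v h (by omega) m hm
    have hw := weightEntry_nonneg G w (v + n * u)
    -- Weights are nonnegative, so the entry pointed to is below `big` too. Hence the chain of
    -- pointers cannot end in a dummy value of layer `0`.
    obtain ⟨p, hp, hcov⟩ := ih (v := u) (by omega) hcl (by linarith) (fun i hi a b hab => by
      refine hH (i + 1) (by omega) a b ?_
      rw [Function.iterate_succ_apply, hP, hab])
    have hcov' : ∀ i : Fin k, m.testBit i = true → r i = v ∨ r i ∈ p.support := by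
      intro i hi
      by_cases hiv : r i = v
      · exact Or.inl hiv
      · exact Or.inr (hcov i ((testBit_clearMask _ _ _ _ _).2 ⟨i.isLt, hi, by
          rw [hρ]; exact fun h => hiv (Fin.ext h)⟩))
    rcases huv with rfl | huv
    · refine ⟨p, ?_, fun i hi => ?_⟩
      · rw [hp, hDe, weightEntry_self, add_zero]
      · rcases hcov' i hi with h1 | h1
        · rw [h1]; exact p.start_mem_support
        · exact h1
    · have hadj : H.Adj v u := by
        refine hH 0 (by omega) v u ?_ huv.symm
        rw [Function.iterate_zero, id, entryEdge, hP, tableIndex_mod _ _ _ _ _ v.isLt,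
          tableIndex_mod _ _ _ _ _ u.isLt]
      refine ⟨.cons hadj p, ?_, fun i hi => ?_⟩
      · rw [walkLength_cons, hDe, weightEntry_adj huv, Sym2.eq_swap]
        push_cast
        rw [hp]; ring
      · rcases hcov' i hi with h1 | h1
        · simp [h1]
        · simp [h1]

/-- `exists_short_walk` makes `2 n` hops enough: the last layer bounds walks of every length from
below. -/
lemma final_le_walkLength (T : IsTable G w k ρ big D P) (hρ : ∀ i : Fin k, ρ i = r i)
    {s v : Fin n} {m : ℕ} (p : G.Walk v s) (hm : m < 2 ^ k) (hc : Covers r m p) :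
    D (tableIndex n k s (2 * n) m v) ≤ walkLength w p := by
  obtain ⟨q, h1, h2, h3⟩ := exists_short_walk w p
  refine (T.le_walkLength hρ q (by simpa using h1) le_rfl hm fun i hi => h3 _ (hc i hi)).trans ?_
  exact_mod_cast h2

lemma exists_covering_walk (hG : G.Connected) (r : Fin k → Fin n) (v s : Fin n) :
    ∃ p : G.Walk v s, ∀ i, r i ∈ p.support := by
  have key : ∀ l : List (Fin n), ∃ p : G.Walk v s, ∀ x ∈ l, x ∈ p.support := by
    intro l
    induction l with
    | nil => exact ⟨(hG v s).some, by simp⟩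
    | cons x l ih =>
      obtain ⟨p, hp⟩ := ih
      refine ⟨(hG v x).some.append ((hG x v).some.append p), fun y hy => ?_⟩
      rcases List.mem_cons.1 hy with rfl | hy
      · simp [SimpleGraph.Walk.mem_support_append_iff]
      · simp [SimpleGraph.Walk.mem_support_append_iff, hp y hy]
  obtain ⟨p, hp⟩ := key (List.ofFn r)
  exact ⟨p, fun i => hp _ (by simp)⟩

/-- In a connected graph some walk visits all terminals, and a short replacement of it costs less
than `big`. So final entries are costs of actual walks. -/
lemma final_lt (hbig : ∀ (u v : Fin n) (p : G.Walk u v),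
    p.length ≤ 2 * n → (walkLength w p : ℝ) < big)
    (T : IsTable G w k ρ big D P) (hρ : ∀ i : Fin k, ρ i = r i) (hG : G.Connected)
    (s v : Fin n) {m : ℕ} (hm : m < 2 ^ k) : D (tableIndex n k s (2 * n) m v) < big := by
  obtain ⟨p, hp⟩ := exists_covering_walk hG r v s
  obtain ⟨q, h1, -, h3⟩ := exists_short_walk w p
  have h1 : q.length ≤ 2 * n := by simpa using h1
  exact (T.le_walkLength hρ q h1 le_rfl hm fun i _ => h3 _ (hp i)).trans_lt (hbig _ _ q h1)

lemma exists_walk_final (hbig : ∀ (u v : Fin n) (p : G.Walk u v),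
    p.length ≤ 2 * n → (walkLength w p : ℝ) < big)
    (T : IsTable G w k ρ big D P) (hρ : ∀ i : Fin k, ρ i = r i)
    (hG : G.Connected) (s v : Fin n) {m : ℕ} (hm : m < 2 ^ k) :
    ∃ p : G.Walk v s, (walkLength w p : ℝ) = D (tableIndex n k s (2 * n) m v) ∧ Covers r m p :=
  T.exists_walk hρ G le_rfl hm (final_lt hbig T hρ hG s v hm) (fun _ _ _ _ _ h => h)

/-- The hop bound from which on the table entries for the distance from `v` to `s` are final. -/
noncomputable def settleHop (n k : ℕ) (D : ℕ → ℝ) (s v : ℕ) : ℕ :=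
  settle (fun h => D (tableIndex n k s h 0 v)) (D (tableIndex n k s (2 * n) 0 v)) (2 * n)

/-- Staying in place costs nothing, and the mask `0` is not changed by clearing. -/
lemma antitone_hop (T : IsTable G w k ρ big D P) (s v : Fin n) {h h' : ℕ} (hle : h ≤ h')
    (hh : h' ≤ 2 * n) : D (tableIndex n k s h' 0 v) ≤ D (tableIndex n k s h 0 v) := by
  induction h', hle using Nat.le_induction with
  | base => exact le_rfl
  | succ h' hle ih =>
    have h1 := T.opt s v h' (by omega) 0 (by positivity) v (Or.inl rfl)
    rw [weightEntry_self, add_zero, clearMask_zero] at h1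
    exact h1.trans (ih (by omega))

/-- The edges at the settled entries form a shortest path tree. -/
lemma exists_tree_walk (hbig : ∀ (u v : Fin n) (p : G.Walk u v),
    p.length ≤ 2 * n → (walkLength w p : ℝ) < big)
    (T : IsTable G w k ρ big D P) (hρ : ∀ i : Fin k, ρ i = r i)
    (hG : G.Connected) (H : SimpleGraph (Fin n)) (s : Fin n)
    (hH : ∀ v a b : Fin n,
      s((a : ℕ), (b : ℕ)) = entryEdge n P (tableIndex n k s (settleHop n k D s v) 0 v) →
      G.Adj a b → H.Adj a b) (v : Fin n) :
    ∃ p : H.Walk v s, (walkLength w p : ℝ) ≤ D (tableIndex n k s (2 * n) 0 v) := by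
  have h2k : 0 < 2 ^ k := by positivity
  induction hd : settleHop n k D s v using Nat.strong_induction_on generalizing v with
  | _ d ih =>
    have hn : 0 < n := v.pos
    have hd2 : d ≤ 2 * n := hd ▸ settle_le _ _ _
    have hfin : D (tableIndex n k s d 0 v) ≤ D (tableIndex n k s (2 * n) 0 v) := by
      rcases hd2.eq_or_lt with rfl | hlt
      · exact le_rfl
      · exact le_of_settle_le (fun h => D (tableIndex n k s h 0 v)) _ (by exact hd.le) hlt
    have hlt := final_lt hbig T hρ hG s v h2k
    -- If `v` is settled at hop `0`, its entry of layer `0` is below `big`, so `v` is the source.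
    rcases d with _ | h
    · have h1 := T.init s v 0 h2k
      split_ifs at h1 with hc
      · obtain ⟨-, rfl⟩ := hc
        exact ⟨.nil, by simpa [← h1] using hfin⟩
      · linarith
    · have hgap : D (tableIndex n k s (2 * n) 0 v) < D (tableIndex n k s h 0 v) :=
        lt_of_settle_eq (fun h => D (tableIndex n k s h 0 v)) _ hd
      obtain ⟨u, huv, hP, hD⟩ := T.step s v h (by omega) 0 h2k
      rw [clearMask_zero] at hP hD
      -- Staying at `v` would make the layers `h` and `h + 1` agree, against `hgap`.
      rcases huv with rfl | huv
      · rw [weightEntry_self] at hD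
        linarith
      rw [weightEntry_adj huv] at hD
      obtain ⟨q, hq, -⟩ := exists_walk_final hbig T hρ hG s u h2k
      have h1 := T.final_le_walkLength hρ (.cons huv.symm q) h2k (fun i hi => by simp at hi)
      rw [walkLength_cons, Sym2.eq_swap] at h1
      push_cast at h1
      -- The entry of `u` in layer `h` is final: otherwise the final value of `v` would exceed the
      -- weight of the edge plus the final value of `u`, against `h1`. So settling hops drop
      -- strictly along the tree, even on edges of weight `0`.
      have hset : settleHop n k D s u ≤ h := by
        by_contra! hcon
        obtain ⟨h', hh'⟩ : ∃ h', settleHop n k D s u = h' + 1 := ⟨_, (Nat.succ_pred (by omega)).symm⟩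
        have h2 : h' + 1 ≤ 2 * n := hh' ▸ settle_le _ _ _
        have h3 := lt_of_settle_eq (fun h => D (tableIndex n k s h 0 u)) _ hh'
        have h4 := T.antitone_hop s u (h := h) (h' := h') (by omega) (by omega)
        linarith
      obtain ⟨p, hp⟩ := ih _ (by omega) u rfl
      have h5 := T.antitone_hop s u (h := h) (h' := 2 * n) (by omega) le_rfl
      have hadj : H.Adj v u := by
        refine hH v v u ?_ huv.symm
        rw [hd, entryEdge, hP, tableIndex_mod _ _ _ _ _ v.isLt, tableIndex_mod _ _ _ _ _ u.isLt]
      refine ⟨.cons hadj p, ?_⟩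
      rw [walkLength_cons, Sym2.eq_swap]
      push_cast
      linarith

end IsTable

/-! ### The marked edges: stretch and size -/

/-- The edges marked for the shortest path tree of `p`. -/
noncomputable def treeMarks (n k : ℕ) (D : ℕ → ℝ) (P : ℕ → ℕ) (p : ℕ) : Finset (Sym2 ℕ) :=
  (Finset.range n).image fun t =>
    entryEdge n P (tableIndex n k p (IsTable.settleHop n k D p t) 0 t)

/-- The edges marked for the cheapest group Steiner path between `p` and `q`. -/
def walkMarks (n k : ℕ) (P : ℕ → ℕ) (p q : ℕ) : Finset (Sym2 ℕ) :=
  (Finset.range (2 * n)).image fun i =>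
    entryEdge n P (P^[i] (tableIndex n k p (2 * n) (2 ^ k - 1) q))

/-- The edges marked for the net `N`. -/
noncomputable def netMarks (n k : ℕ) (D : ℕ → ℝ) (P : ℕ → ℕ) (N : Finset ℕ) : Finset (Sym2 ℕ) :=
  N.biUnion fun p => treeMarks n k D P p ∪ N.biUnion fun q => walkMarks n k P p q

/-- Each net point marks one edge per vertex, and each ordered pair of net points marks at most `2
n` edges. -/
lemma card_netMarks_le (n k : ℕ) (D : ℕ → ℝ) (P : ℕ → ℕ) (N : Finset ℕ) :
    (netMarks n k D P N).card ≤ N.card * (n + N.card * (2 * n)) := by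
  refine Finset.card_biUnion_le_card_mul _ _ _ fun p _ => (Finset.card_union_le _ _).trans ?_
  refine add_le_add ?_ (Finset.card_biUnion_le_card_mul _ _ _ fun q _ => ?_)
  · exact Finset.card_image_le.trans (by simp)
  · exact Finset.card_image_le.trans (by simp)

/-- The graph of the marked edges of `G`. -/
def markedGraph (G : SimpleGraph (Fin n)) (E : Finset (Sym2 ℕ)) : SimpleGraph (Fin n) where
  -- Intersecting with `G` discards meaningless marks: loops from pointers that stay in place, and
  -- pairs read off layer `0`, where `IsTable` does not constrain the pointers.
  Adj u v := G.Adj u v ∧ s((u : ℕ), (v : ℕ)) ∈ E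
  symm := ⟨fun u v h => ⟨h.1.symm, by rw [Sym2.eq_swap]; exact h.2⟩⟩
  loopless := ⟨fun u h => G.loopless.irrefl u h.1⟩

lemma ncard_edgeSet_markedGraph_le (G : SimpleGraph (Fin n)) (E : Finset (Sym2 ℕ)) :
    (markedGraph G E).edgeSet.ncard ≤ E.card := by
  rw [← Set.ncard_coe_finset E]
  refine Set.ncard_le_ncard_of_injOn (Sym2.map (fun x : Fin n => (x : ℕ))) ?_
    (Sym2.map.injective Fin.val_injective).injOn (Finset.finite_toSet E)
  intro e he
  induction e using Sym2.ind with
  | _ a b => exact he.2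

section Main

variable {G : SimpleGraph (Fin n)} {w : Sym2 (Fin n) → ℝ≥0} {ρ : ℕ → ℕ} {r : Fin k → Fin n}
  {big L ε : ℝ} {D : ℕ → ℝ} {P : ℕ → ℕ}

/-- The marked edges form a sparse group Steiner spanner. -/
theorem markedGraph_isSpanner (T : IsTable G w k ρ big D P) (hρ : ∀ i : Fin k, ρ i = r i)
    (hk : 0 < k) (hG : G.Connected) (hε : 0 < ε) (hε1 : ε < 1)
    (hbig : ∀ (u v : Fin n) (p : G.Walk u v), p.length ≤ 2 * n → (walkLength w p : ℝ) < big)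
    (hL : ∀ s t : Fin n, L ≤ D (tableIndex n k s (2 * n) (2 ^ k - 1) t))
    (hL' : ∃ s t : Fin n, L = D (tableIndex n k s (2 * n) (2 ^ k - 1) t))
    (N : Finset ℕ) (hN : ∀ x ∈ N, ∃ i : Fin k, x = r i)
    (hsep : ∀ x ∈ N, ∀ y ∈ N, x ≠ y → ε * L < 4 * D (tableIndex n k x (2 * n) 0 y) ∨
      ε * L < 4 * D (tableIndex n k y (2 * n) 0 x))
    (hcov : ∀ i : Fin k, ∃ x ∈ N, 4 * D (tableIndex n k x (2 * n) 0 (r i)) ≤ ε * L) :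
    IsSpanner G (markedGraph G (netMarks n k D P N)) w
        (fun i : Fin k => ({r i} : Set (Fin n))) (1 + ε) ∧
      ((markedGraph G (netMarks n k D P N)).edgeSet.ncard : ℝ) ≤ 75 * (n / ε ^ 2) := by
  have h2k : 0 < 2 ^ k := by positivity
  have hfull : 2 ^ k - 1 < 2 ^ k := by omega
  have hcovfull : ∀ {H : SimpleGraph (Fin n)} {u v : Fin n} (p : H.Walk u v),
      Covers r (2 ^ k - 1) p ↔ ∀ i, r i ∈ p.support := by
    intro H u v p
    simp [Covers, Nat.testBit_two_pow_sub_one]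
  constructor
  · refine ⟨fun u v h => h.1, fun s t => ?_⟩
    have hc0 : ENNReal.ofReal (1 + ε) ≠ 0 := by
      rw [Ne, ENNReal.ofReal_eq_zero, not_le]; linarith
    unfold dist
    rw [ENNReal.mul_iInf_of_ne hc0 ENNReal.ofReal_ne_top]
    refine le_iInf fun p => ?_
    rw [ENNReal.mul_iInf_of_ne hc0 ENNReal.ofReal_ne_top]
    refine le_iInf fun hp => ?_
    replace hp : ∀ i, r i ∈ p.support := fun i => by
      obtain ⟨v, rfl, hv⟩ := hp i
      exact hv
    -- All terminals lie on the middle part `q₂`, between the first terminal `r i` and the last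
    -- terminal `r j`.
    obtain ⟨a, b, ⟨i, rfl⟩, ⟨j, rfl⟩, q₁, q₂, q₃, hlen, hsub⟩ :=
      exists_split_first_last w (fun v => ∃ i, v = r i) p ⟨r ⟨0, hk⟩, hp _, _, rfl⟩
    obtain ⟨x, hx, hxi⟩ := hcov i
    obtain ⟨y, hy, hyj⟩ := hcov j
    obtain ⟨i', rfl⟩ := hN x hx
    obtain ⟨j', rfl⟩ := hN y hy
    set H := markedGraph G (netMarks n k D P N) with hH
    have htree : ∀ c : Fin n, (c : ℕ) ∈ N → ∀ v : Fin n, ∃ p : H.Walk v c,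
        (walkLength w p : ℝ) ≤ D (tableIndex n k c (2 * n) 0 v) := fun c hc =>
      IsTable.exists_tree_walk hbig T hρ hG H c (fun v a b hab hadj => ⟨hadj, by
        rw [hab]
        exact Finset.mem_biUnion.2 ⟨c, hc, Finset.mem_union_left _ (Finset.mem_image.2
          ⟨v, by simp, rfl⟩)⟩⟩)
    obtain ⟨p₁, hp₁⟩ := htree (r i') hx s
    obtain ⟨p₃, hp₃⟩ := htree (r j') hy t
    obtain ⟨p₂, hp₂, hcp₂⟩ := T.exists_walk (r := r) hρ H (s := r i') (v := r j') le_rfl hfull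
      (IsTable.final_lt hbig T hρ hG _ _ hfull) (fun l hl a b hab hadj => ⟨hadj, by
        rw [hab]
        exact Finset.mem_biUnion.2 ⟨_, hx, Finset.mem_union_right _ (Finset.mem_biUnion.2
          ⟨_, hy, Finset.mem_image.2 ⟨l, by simpa using hl, rfl⟩⟩)⟩⟩)
    -- The detours from `r i` and `r j` to their net points, each of length at most `ε L / 4`. They
    -- occur only in the estimates and need not lie in `H`.
    obtain ⟨d₁, hd₁, -⟩ := IsTable.exists_walk_final hbig T hρ hG (r i') (r i) h2k
    obtain ⟨d₂, hd₂, -⟩ := IsTable.exists_walk_final hbig T hρ hG (r j') (r j) h2k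
    have e₁ := T.final_le_walkLength hρ (q₁.append d₁) h2k (fun i hi => by simp at hi)
    have e₃ := T.final_le_walkLength hρ (q₃.reverse.append d₂) h2k (fun i hi => by simp at hi)
    have e₂ := T.final_le_walkLength hρ (d₂.reverse.append (q₂.reverse.append d₁)) hfull
      ((hcovfull _).2 fun l => by
        simp [SimpleGraph.Walk.mem_support_append_iff, hsub _ (hp l) ⟨l, rfl⟩])
    have eL := (hL t s).trans (T.final_le_walkLength hρ p hfull ((hcovfull _).2 hp))
    simp only [walkLength_append, walkLength_reverse] at e₁ e₂ e₃
    have hlen' : (walkLength w p : ℝ) = walkLength w q₁ + walkLength w q₂ + walkLength w q₃ := by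
      exact_mod_cast hlen
    push_cast at e₁ e₂ e₃
    -- The left side is at most `|q₁| + |q₂| + |q₃| + 2 |d₁| + 2 |d₂| ≤ |p| + ε L`, and `L ≤ |p|` by
    -- `eL`.
    have hfin : (walkLength w (p₁.append (p₂.reverse.append p₃.reverse)) : ℝ) ≤
        (1 + ε) * walkLength w p := by
      simp only [walkLength_append, walkLength_reverse]
      push_cast
      nlinarith
    refine (iInf₂_le (p₁.append (p₂.reverse.append p₃.reverse)) fun l => ⟨r l, rfl, ?_⟩).trans ?_
    · rw [← ENNReal.ofReal_coe_nnreal, ← ENNReal.ofReal_coe_nnreal,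
        ← ENNReal.ofReal_mul (by linarith)]
      exact ENNReal.ofReal_le_ofReal hfin
    · simp [SimpleGraph.Walk.mem_support_append_iff, (hcovfull _).1 hcp₂ l]
  · obtain ⟨s, t, hst⟩ := hL'
    -- A walk of length exactly `L` visits all terminals, hence all of `N`; this bounds the size of
    -- the net.
    obtain ⟨p, hp, hcp⟩ := IsTable.exists_walk_final hbig T hρ hG s t hfull
    rw [← hst] at hp
    have hcard : (N.card : ℝ) ≤ 5 / ε := by
      have hlt : ∀ x ∈ N, x < n := fun x hx => by
        obtain ⟨i, rfl⟩ := hN x hx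
        exact (r i).isLt
      have h1 := card_separated_le w hε hε1 p (N.attachFin hlt)
        (fun v hv => by
          obtain ⟨i, hi⟩ := hN v (by simpa using hv)
          rw [Fin.ext hi]
          exact (hcovfull _).1 hcp i)
        (fun a ha b hb hab q => by
          rw [hp]
          have h1 := T.final_le_walkLength hρ q h2k (fun i hi => by simp at hi)
          have h2 := T.final_le_walkLength hρ q.reverse h2k (fun i hi => by simp at hi)
          rw [walkLength_reverse] at h2
          rcases hsep a (by simpa using ha) b (by simpa using hb)
            (fun h => hab (Fin.ext h)) with h3 | h3 <;> linarith)
      simpa using h1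
    have h1 := (ncard_edgeSet_markedGraph_le G _).trans (card_netMarks_le n k D P N)
    have h2 : ((markedGraph G (netMarks n k D P N)).edgeSet.ncard : ℝ) ≤
        N.card * (n + N.card * (2 * n)) := by exact_mod_cast h1
    refine h2.trans ?_
    have hn : (0 : ℝ) ≤ n := Nat.cast_nonneg n
    calc (N.card : ℝ) * (n + N.card * (2 * n)) ≤ 5 / ε * (n + 5 / ε * (2 * n)) := by gcongr
      _ = (5 * ε + 50) * (n / ε ^ 2) := by field_simp; ring
      _ ≤ 75 * (n / ε ^ 2) := by gcongr; linarith

end Main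

end GroupSteiner

/-! ### A program logic: frames, step bounds and loops -/

namespace RealRAM

/-- `p` assigns to the integer variable `x`. -/
def Prog.setsN : Prog → ℕ → Bool
  | .nset y _, x => y == x
  | .seq p q, x => p.setsN x || q.setsN x
  | .ite _ p q, x => p.setsN x || q.setsN x
  | .loop _ p, x => p.setsN x
  | _, _ => false

/-- `p` writes to the integer array `a`. -/
def Prog.putsN : Prog → ℕ → Bool
  | .nput b _ _, a => b == a
  | .seq p q, a => p.putsN a || q.putsN a
  | .ite _ p q, a => p.putsN a || q.putsN a
  | .loop _ p, a => p.putsN a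
  | _, _ => false

/-- `p` assigns to the real variable `x`. -/
def Prog.setsR : Prog → ℕ → Bool
  | .rset y _, x => y == x
  | .seq p q, x => p.setsR x || q.setsR x
  | .ite _ p q, x => p.setsR x || q.setsR x
  | .loop _ p, x => p.setsR x
  | _, _ => false

/-- `p` writes to the real array `a`. -/
def Prog.putsR : Prog → ℕ → Bool
  | .rput b _ _, a => b == a
  | .seq p q, a => p.putsR a || q.putsR a
  | .ite _ p q, a => p.putsR a || q.putsR a
  | .loop _ p, a => p.putsR a
  | _, _ => false

/-- `s` and `s'` agree on everything that `p` does not write. -/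
structure Frame (p : Prog) (s s' : State) : Prop where
  nvar : ∀ x, p.setsN x = false → s'.nvar x = s.nvar x
  narr : ∀ a, p.putsN a = false → s'.narr a = s.narr a
  rvar : ∀ x, p.setsR x = false → s'.rvar x = s.rvar x
  rarr : ∀ a, p.putsR a = false → s'.rarr a = s.rarr a

lemma Frame.refl (p : Prog) (s : State) : Frame p s s :=
  ⟨fun _ _ => rfl, fun _ _ => rfl, fun _ _ => rfl, fun _ _ => rfl⟩

lemma Frame.trans {p q r : Prog} {s s' s'' : State} (h : Frame p s s') (h' : Frame q s' s'')
    (hN : ∀ x, r.setsN x = false → p.setsN x = false ∧ q.setsN x = false)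
    (hA : ∀ x, r.putsN x = false → p.putsN x = false ∧ q.putsN x = false)
    (hR : ∀ x, r.setsR x = false → p.setsR x = false ∧ q.setsR x = false)
    (hB : ∀ x, r.putsR x = false → p.putsR x = false ∧ q.putsR x = false) : Frame r s s'' :=
  ⟨fun x hx => (h'.nvar x (hN x hx).2).trans (h.nvar x (hN x hx).1),
    fun x hx => (h'.narr x (hA x hx).2).trans (h.narr x (hA x hx).1),
    fun x hx => (h'.rvar x (hR x hx).2).trans (h.rvar x (hR x hx).1),
    fun x hx => (h'.rarr x (hB x hx).2).trans (h.rarr x (hB x hx).1)⟩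

/-- A program changes only what it writes. -/
lemma Exec.frame {W : ℕ} {p : Prog} {s s' : State} {T : ℕ} (h : Exec W p s T s') :
    Frame p s s' := by
  induction h with
  | skip s => exact .refl _ _
  | nset x e s _ =>
    refine ⟨fun y hy => ?_, fun _ _ => rfl, fun _ _ => rfl, fun _ _ => rfl⟩
    exact Function.update_of_ne (by rintro rfl; simp [Prog.setsN] at hy) _ _
  | nput a i e s _ _ =>
    refine ⟨fun _ _ => rfl, fun y hy => ?_, fun _ _ => rfl, fun _ _ => rfl⟩
    exact Function.update_of_ne (by rintro rfl; simp [Prog.putsN] at hy) _ _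
  | rset x e s _ =>
    refine ⟨fun _ _ => rfl, fun _ _ => rfl, fun y hy => ?_, fun _ _ => rfl⟩
    exact Function.update_of_ne (by rintro rfl; simp [Prog.setsR] at hy) _ _
  | rput a i e s _ _ =>
    refine ⟨fun _ _ => rfl, fun _ _ => rfl, fun _ _ => rfl, fun y hy => ?_⟩
    exact Function.update_of_ne (by rintro rfl; simp [Prog.putsR] at hy) _ _
  | seq _ _ ih₁ ih₂ =>
    exact ih₁.trans ih₂ (by simp [Prog.setsN]) (by simp [Prog.putsN]) (by simp [Prog.setsR])
      (by simp [Prog.putsR])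
  | ite_true _ _ _ ih =>
    exact ih.trans (.refl .skip _) (by simp +contextual [Prog.setsN])
      (by simp +contextual [Prog.putsN]) (by simp +contextual [Prog.setsR])
      (by simp +contextual [Prog.putsR])
  | ite_false _ _ _ ih =>
    exact ih.trans (.refl .skip _) (by simp +contextual [Prog.setsN])
      (by simp +contextual [Prog.putsN]) (by simp +contextual [Prog.setsR])
      (by simp +contextual [Prog.putsR])
  | loop_false _ _ => exact .refl _ _
  | loop_true _ _ _ _ ih₁ ih₂ =>
    exact ih₁.trans ih₂ (by simp [Prog.setsN]) (by simp [Prog.putsN]) (by simp [Prog.setsR])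
      (by simp [Prog.putsR])

/-- Started in `s`, the program `p` halts after at most `T` steps in a state that satisfies `Q`. -/
def Halts (W : ℕ) (p : Prog) (s : State) (T : ℕ) (Q : State → Prop) : Prop :=
  ∃ T' ≤ T, ∃ s', Exec W p s T' s' ∧ Q s'

namespace Halts

variable {W : ℕ} {p q : Prog} {s : State} {T T' : ℕ} {Q R : State → Prop}

lemma mono (h : Halts W p s T Q) (hT : T ≤ T') : Halts W p s T' Q :=
  let ⟨T₁, h₁, h₂⟩ := h
  ⟨T₁, h₁.trans hT, h₂⟩

lemma conseq (h : Halts W p s T R) (hQ : ∀ s', Frame p s s' → R s' → Q s') : Halts W p s T Q :=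
  let ⟨T₁, h₁, s', h₂, h₃⟩ := h
  ⟨T₁, h₁, s', h₂, hQ s' h₂.frame h₃⟩

lemma skip (h : Q s) : Halts W .skip s 1 Q := ⟨1, le_rfl, s, .skip s, h⟩

lemma nset {x : ℕ} {e : NExp} (he : e.Fits W s)
    (h : Q { s with nvar := Function.update s.nvar x (e.eval s) }) :
    Halts W (.nset x e) s (e.cost + 1) Q :=
  ⟨_, le_rfl, _, .nset x e s he, h⟩

lemma nput {a : ℕ} {i e : NExp} (hi : i.Fits W s) (he : e.Fits W s)
    (h : Q { s with narr := Function.update s.narr a (Function.update (s.narr a) (i.eval s) (e.eval s)) }) :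
    Halts W (.nput a i e) s (i.cost + e.cost + 1) Q :=
  ⟨_, le_rfl, _, .nput a i e s hi he, h⟩

lemma rset {x : ℕ} {e : RExp} (he : e.Fits W s)
    (h : Q { s with rvar := Function.update s.rvar x (e.eval s) }) :
    Halts W (.rset x e) s (e.cost + 1) Q :=
  ⟨_, le_rfl, _, .rset x e s he, h⟩

lemma rput {a : ℕ} {i : NExp} {e : RExp} (hi : i.Fits W s) (he : e.Fits W s)
    (h : Q { s with rarr := Function.update s.rarr a (Function.update (s.rarr a) (i.eval s) (e.eval s)) }) :
    Halts W (.rput a i e) s (i.cost + e.cost + 1) Q :=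
  ⟨_, le_rfl, _, .rput a i e s hi he, h⟩

/-- The frame of `p` is passed on, so the assertion `R` only has to speak of what `p` changes. -/
lemma seq (hp : Halts W p s T R) (hq : ∀ s', Frame p s s' → R s' → Halts W q s' T' Q) :
    Halts W (.seq p q) s (T + T') Q := by
  obtain ⟨T₁, h₁, s₁, h₂, h₃⟩ := hp
  obtain ⟨T₂, h₄, s₂, h₅, h₆⟩ := hq s₁ h₂.frame h₃
  exact ⟨T₁ + T₂, add_le_add h₁ h₄, s₂, .seq h₂ h₅, h₆⟩

lemma ite {b : BExp} (hf : b.Fits W s) (hp : b.eval s → Halts W p s T Q)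
    (hq : ¬ b.eval s → Halts W q s T Q) : Halts W (.ite b p q) s (b.cost + T) Q := by
  by_cases hb : b.eval s
  · obtain ⟨T₁, h₁, s₁, h₂, h₃⟩ := hp hb
    exact ⟨b.cost + T₁, by omega, s₁, .ite_true hf hb h₂, h₃⟩
  · obtain ⟨T₁, h₁, s₁, h₂, h₃⟩ := hq hb
    exact ⟨b.cost + T₁, by omega, s₁, .ite_false hf hb h₂, h₃⟩

end Halts

/-- The test that the integer variable `x` is below the integer variable `y`. -/
def ltTest (x y : ℕ) : BExp := .not (.nle (.var y) (.var x))

/-- Run `p` for the values of the integer variable `x` from `0` up to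
(and not including) the value of the integer variable `y`. -/
def forLoop (x y : ℕ) (p : Prog) : Prog :=
  .seq (.nset x (.lit 0)) (.loop (ltTest x y) (.seq p (.nset x (.add (.var x) (.lit 1)))))

/-- A round costs `T` for the body, `4` for the test and `4` for the increment; the extra `6` are
the initialization and the failing last test. `N < W` keeps the counter from overflowing. The frame
in `step` starts before the loop, so whatever the loop does not write is known in every round. -/
theorem Halts.forLoop {W x y : ℕ} {p : Prog} {s : State} {N T : ℕ} (I : ℕ → State → Prop)
    (hN : s.nvar y = N) (hNW : N < W) (hxy : (x == y) = false) (hx : p.setsN x = false)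
    (hy : p.setsN y = false) (h0 : I 0 { s with nvar := Function.update s.nvar x 0 })
    (step : ∀ i < N, ∀ s', Frame (forLoop x y p) s s' → s'.nvar x = i → I i s' →
      Halts W p s' T fun s'' => I (i + 1) { s'' with nvar := Function.update s''.nvar x (i + 1) }) :
    Halts W (forLoop x y p) s (N * (T + 8) + 6) (I N) := by
  have hxy' : y ≠ x := fun h => by simp [h] at hxy
  have hyf : (RealRAM.forLoop x y p).setsN y = false := by
    simp [RealRAM.forLoop, Prog.setsN, hy, hxy'.symm]
  have key : ∀ d i, i + d = N → ∀ s', Frame (RealRAM.forLoop x y p) s s' → s'.nvar x = i →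
      I i s' → Halts W (.loop (ltTest x y) (.seq p (.nset x (.add (.var x) (.lit 1))))) s'
        (d * (T + 8) + 4) (I N) := by
    intro d
    induction d with
    | zero =>
      intro i hi s' hs' hxi hI
      obtain rfl : i = N := by omega
      refine ⟨_, le_rfl, s', ?_, hI⟩
      have : (ltTest x y).cost = 0 * (T + 8) + 4 := by simp [ltTest, BExp.cost, NExp.cost]
      rw [← this]
      refine .loop_false ⟨trivial, trivial⟩ ?_
      simp [ltTest, BExp.eval, NExp.eval, hxi, hs'.nvar y hyf, hN]
    | succ d ih =>
      intro i hi s' hs' hxi hI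
      obtain ⟨T₁, h₁, s₁, h₂, h₃⟩ := step i (by omega) s' hs' hxi hI
      have hs₁ : s₁.nvar x = i := by rw [h₂.frame.nvar x hx, hxi]
      have hset : Exec W (.nset x (.add (.var x) (.lit 1))) s₁ 4
          { s₁ with nvar := Function.update s₁.nvar x (i + 1) } := by
        have h := Exec.nset (W := W) x (.add (.var x) (.lit 1)) s₁
          ⟨trivial, by simp only [NExp.Fits]; omega, by simp only [NExp.eval, hs₁]; omega⟩
        simpa only [NExp.eval, hs₁, NExp.cost] using h
      have hbody := Exec.seq h₂ hset
      have hs₂ : Frame (RealRAM.forLoop x y p) s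
          { s₁ with nvar := Function.update s₁.nvar x (i + 1) } :=
        hs'.trans hbody.frame (by simp +contextual [RealRAM.forLoop, Prog.setsN])
          (by simp +contextual [RealRAM.forLoop, Prog.putsN])
          (by simp +contextual [RealRAM.forLoop, Prog.setsR])
          (by simp +contextual [RealRAM.forLoop, Prog.putsR])
      obtain ⟨T₂, h₄, s₂, h₅, h₆⟩ := ih (i + 1) (by omega) _ hs₂ (by simp) h₃
      refine ⟨4 + (T₁ + 4) + T₂, by rw [Nat.succ_mul]; omega, s₂, ?_, h₆⟩
      refine Exec.loop_true (b := ltTest x y) ⟨trivial, trivial⟩ ?_ hbody h₅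
      simp only [ltTest, BExp.eval, NExp.eval, hxi, hs'.nvar y hyf, hN]
      omega
  have hset : Exec W (.nset x (.lit 0)) s 2 { s with nvar := Function.update s.nvar x 0 } :=
    Exec.nset x (.lit 0) s (Nat.zero_le _)
  obtain ⟨T₁, h₁, s₁, h₂, h₃⟩ := key N 0 (by omega) _
    (hset.frame.trans (.refl .skip _) (by simp +contextual [RealRAM.forLoop, Prog.setsN])
      (by simp +contextual [RealRAM.forLoop, Prog.putsN])
      (by simp +contextual [RealRAM.forLoop, Prog.setsR])
      (by simp +contextual [RealRAM.forLoop, Prog.putsR])) (by simp) h0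
  exact ⟨2 + T₁, by omega, s₁, .seq hset h₂, h₃⟩

/-- The test that two integer expressions have the same value. -/
def eqTest (e f : NExp) : BExp := .and (.nle e f) (.nle f e)

@[simp] lemma eqTest_eval (e f : NExp) (s : State) :
    (eqTest e f).eval s ↔ e.eval s = f.eval s := le_antisymm_iff.symm

@[simp] lemma eqTest_fits (e f : NExp) (W : ℕ) (s : State) :
    (eqTest e f).Fits W s ↔ e.Fits W s ∧ f.Fits W s := by
  simp only [eqTest, BExp.Fits]; tauto

@[simp] lemma eqTest_cost (e f : NExp) :
    (eqTest e f).cost = 2 * (e.cost + f.cost) + 3 := by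
  simp only [eqTest, BExp.cost]; ring

end RealRAM

/-! ### Instances, global constants and table indices -/

namespace RealRAM

open GroupSteiner

/-- The data of an instance: the number of vertices and of terminals, the adjacency matrix, the
list of terminals, the weight matrix, the parameter `ε` and an upper bound `big` on all costs. -/
structure Data where
  n : ℕ
  k : ℕ
  A : ℕ → ℕ
  ρ : ℕ → ℕ
  ω : ℕ → ℝ
  ε : ℝ
  big : ℝ

/-- The number of table entries. -/
def Data.size (d : Data) : ℕ := d.n * (2 * d.n + 1) * 2 ^ d.k * d.n

/-- The assumptions on the data, and on the largest word `W`. -/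
structure Data.Valid (d : Data) (W : ℕ) : Prop where
  n_pos : 0 < d.n
  k_pos : 0 < d.k
  ρ_lt : ∀ i < d.k, d.ρ i < d.n
  ω_self : ∀ v < d.n, d.ω (v + d.n * v) = 0
  size_lt : 4 * d.size + 8 < W

/-- The global constants and the input are in place: integer variables `0` to `6` hold the number
of vertices `n`, the number of terminals `k`, `2 ^ k`, `2 n + 1`, `2 n`, `n * n` and the number of
table entries, real variables `0` and `1` hold `ε` and `big`. -/
structure Env (d : Data) (s : State) : Prop where
  n : s.nvar 0 = d.n
  k : s.nvar 1 = d.k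
  K : s.nvar 2 = 2 ^ d.k
  layers : s.nvar 3 = 2 * d.n + 1
  hops : s.nvar 4 = 2 * d.n
  sq : s.nvar 5 = d.n * d.n
  size : s.nvar 6 = d.size
  A : s.narr 0 = d.A
  ρ : s.narr 1 = d.ρ
  ε : s.rvar 0 = d.ε
  big : s.rvar 1 = d.big
  ω : s.rarr 0 = d.ω

/-- `p` leaves the global constants and the input alone. -/
def Prog.KeepsEnv (p : Prog) : Prop :=
  ((List.range 7).all (fun x => !p.setsN x) && (!p.putsN 0 && !p.putsN 1) &&
    (!p.setsR 0 && !p.setsR 1) && !p.putsR 0) = true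

/-- Which memory a program may write is read off its syntax, so `decide` settles this for concrete
programs. -/
instance (p : Prog) : Decidable p.KeepsEnv := inferInstanceAs (Decidable (_ = true))

lemma Env.of_frame {d : Data} {p : Prog} {s s' : State} (h : Env d s) (hp : p.KeepsEnv)
    (hF : Frame p s s') : Env d s' := by
  simp only [Prog.KeepsEnv, Bool.and_eq_true, List.all_eq_true, List.mem_range,
    Bool.not_eq_true'] at hp
  obtain ⟨⟨⟨hN, hA, hB⟩, hR, hS⟩, hC⟩ := hp
  exact ⟨by rw [hF.nvar _ (hN 0 (by norm_num)), h.n], by rw [hF.nvar _ (hN 1 (by norm_num)), h.k],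
    by rw [hF.nvar _ (hN 2 (by norm_num)), h.K], by rw [hF.nvar _ (hN 3 (by norm_num)), h.layers],
    by rw [hF.nvar _ (hN 4 (by norm_num)), h.hops], by rw [hF.nvar _ (hN 5 (by norm_num)), h.sq],
    by rw [hF.nvar _ (hN 6 (by norm_num)), h.size], by rw [hF.narr _ hA, h.A],
    by rw [hF.narr _ hB, h.ρ], by rw [hF.rvar _ hR, h.ε], by rw [hF.rvar _ hS, h.big],
    by rw [hF.rarr _ hC, h.ω]⟩

section Sizes

variable {d : Data} {W : ℕ}

lemma Data.cell_lt (d : Data) {q m v : ℕ} (hq : q < d.n * (2 * d.n + 1)) (hm : m < 2 ^ d.k)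
    (hv : v < d.n) : (q * 2 ^ d.k + m) * d.n + v < d.size := by
  have h1 : q * 2 ^ d.k + m < d.n * (2 * d.n + 1) * 2 ^ d.k := by
    calc q * 2 ^ d.k + m < (q + 1) * 2 ^ d.k := by rw [Nat.succ_mul]; omega
      _ ≤ _ := Nat.mul_le_mul_right _ hq
  calc (q * 2 ^ d.k + m) * d.n + v < (q * 2 ^ d.k + m + 1) * d.n := by rw [Nat.succ_mul _ d.n]; omega
    _ ≤ _ := Nat.mul_le_mul_right _ h1

lemma Data.layer_lt (d : Data) {s h : ℕ} (hs : s < d.n) (hh : h ≤ 2 * d.n) :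
    s * (2 * d.n + 1) + h < d.n * (2 * d.n + 1) :=
  calc s * (2 * d.n + 1) + h < (s + 1) * (2 * d.n + 1) := by rw [Nat.succ_mul s]; omega
    _ ≤ _ := Nat.mul_le_mul_right _ hs

lemma Data.tableIndex_lt (d : Data) {s h m v : ℕ} (hs : s < d.n) (hh : h ≤ 2 * d.n) (hm : m < 2 ^ d.k)
    (hv : v < d.n) : tableIndex d.n d.k s h m v < d.size :=
  d.cell_lt (d.layer_lt hs hh) hm hv

lemma Data.Valid.pow_le_size (hd : d.Valid W) : 2 ^ d.k ≤ d.size := by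
  have := hd.n_pos
  have h1 : 0 < d.n * (2 * d.n + 1) := by positivity
  calc 2 ^ d.k ≤ d.n * (2 * d.n + 1) * 2 ^ d.k := Nat.le_mul_of_pos_left _ h1
    _ ≤ d.size := Nat.le_mul_of_pos_right _ this

lemma Data.Valid.k_lt_size (hd : d.Valid W) : d.k < d.size := Nat.lt_two_pow_self.trans_le hd.pow_le_size

lemma Data.Valid.hops_lt_size (hd : d.Valid W) : 2 * d.n < d.size := by
  have := hd.n_pos
  calc 2 * d.n < d.n * (2 * d.n + 1) := by nlinarith
    _ ≤ d.n * (2 * d.n + 1) * 2 ^ d.k := Nat.le_mul_of_pos_right _ (by positivity)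
    _ ≤ d.size := Nat.le_mul_of_pos_right _ this

lemma Data.Valid.sq_le_size (hd : d.Valid W) : d.n * d.n ≤ d.size := by
  have := hd.n_pos
  calc d.n * d.n ≤ d.n * (2 * d.n + 1) := by nlinarith
    _ ≤ d.n * (2 * d.n + 1) * 2 ^ d.k := Nat.le_mul_of_pos_right _ (by positivity)
    _ ≤ d.size := Nat.le_mul_of_pos_right _ this

lemma Data.Valid.mul_pow_le_size (hd : d.Valid W) : d.n * 2 ^ d.k ≤ d.size := by
  have := hd.n_pos
  calc d.n * 2 ^ d.k ≤ d.n * (2 * d.n + 1) * 2 ^ d.k :=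
        Nat.mul_le_mul_right _ (Nat.le_mul_of_pos_right _ (by positivity))
    _ ≤ d.size := Nat.le_mul_of_pos_right _ this

lemma pair_lt {n u v : ℕ} (hu : u < n) (hv : v < n) : v + n * u < n * n :=
  calc v + n * u < n * (u + 1) := by rw [Nat.mul_succ]; omega
    _ ≤ _ := Nat.mul_le_mul_left _ hu

end Sizes

/-- The index of a table entry for the layer `q`, the bit mask `m` and the vertex `v`. -/
def cellExp (q m v : NExp) : NExp := .add (.mul (.add (.mul q (.var 2)) m) (.var 0)) v

/-- The index of a table entry for the source `a` and the hop bound `h`. -/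
def indexExp (a h m v : NExp) : NExp := cellExp (.add (.mul a (.var 3)) h) m v

section Expressions

variable {d : Data} {W : ℕ} {s : State}

lemma cellExp_eval (hs : Env d s) (q m v : NExp) :
    (cellExp q m v).eval s = (q.eval s * 2 ^ d.k + m.eval s) * d.n + v.eval s := by
  simp [cellExp, NExp.eval, hs.K, hs.n]

lemma indexExp_eval (hs : Env d s) (a h m v : NExp) :
    (indexExp a h m v).eval s = tableIndex d.n d.k (a.eval s) (h.eval s) (m.eval s) (v.eval s) := by
  simp [indexExp, cellExp_eval hs, NExp.eval, hs.layers, tableIndex]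

lemma cellExp_fits (hd : d.Valid W) (hs : Env d s) {q m v : NExp} (hq : q.Fits W s)
    (hm : m.Fits W s) (hv : v.Fits W s) (hq' : q.eval s < d.n * (2 * d.n + 1))
    (hm' : m.eval s < 2 ^ d.k) (hv' : v.eval s < d.n) : (cellExp q m v).Fits W s := by
  have h1 := d.cell_lt hq' hm' hv'
  have h2 := hd.size_lt
  have h3 := Nat.le_mul_of_pos_right (q.eval s * 2 ^ d.k + m.eval s) hd.n_pos
  simp only [cellExp, NExp.Fits, NExp.eval, hs.K, hs.n, hq, hm, hv, true_and]
  refine ⟨⟨⟨?_, ?_⟩, ?_⟩, ?_⟩ <;> omega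

lemma indexExp_fits (hd : d.Valid W) (hs : Env d s) {a h m v : NExp} (ha : a.Fits W s)
    (hh : h.Fits W s) (hm : m.Fits W s) (hv : v.Fits W s) (ha' : a.eval s < d.n)
    (hh' : h.eval s ≤ 2 * d.n) (hm' : m.eval s < 2 ^ d.k) (hv' : v.eval s < d.n) :
    (indexExp a h m v).Fits W s := by
  have h1 := d.tableIndex_lt ha' hh' hm' hv'
  have h2 := hd.size_lt
  have h3 := Nat.le_mul_of_pos_right
    ((a.eval s * (2 * d.n + 1) + h.eval s) * 2 ^ d.k + m.eval s) hd.n_pos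
  have h4 := Nat.le_mul_of_pos_right (a.eval s * (2 * d.n + 1) + h.eval s)
    (show 0 < 2 ^ d.k by positivity)
  rw [tableIndex] at h1
  refine cellExp_fits hd hs ?_ hm hv ?_ hm' hv'
  · simp only [NExp.Fits, NExp.eval, hs.layers, ha, hh, true_and]
    constructor <;> omega
  · simp only [NExp.eval, hs.layers]
    exact d.layer_lt ha' hh'

end Expressions

/-! #### Clearing the bits of a mask -/

/-- One step of `clearProg`. -/
def clearBody : Prog :=
  .seq (.ite (.and (eqTest (.mod (.div (.var 9) (.var 12)) (.lit 2)) (.lit 1))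
      (.not (eqTest (.get 1 (.var 13)) (.var 8))))
    (.nset 11 (.add (.var 11) (.var 12))) .skip)
  (.nset 12 (.add (.var 12) (.var 12)))

/-- Clear the bits of the terminals at vertex `v` (variable `8`) in the mask `m` (variable `9`);
the result is left in variable `11`. -/
def clearProg : Prog :=
  .seq (.nset 11 (.lit 0)) (.seq (.nset 12 (.lit 1)) (forLoop 13 1 clearBody))

variable {d : Data} {W : ℕ}

/-- Variable `12` runs through the powers `2 ^ i`, so bit `i` of the mask is `m / 2 ^ i % 2`. -/
lemma clearProg_halts (hd : d.Valid W) {s : State} (hs : Env d s) :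
    Halts W clearProg s (52 * d.k)
      fun s' => s'.nvar 11 = clearMask d.ρ (s.nvar 8) (s.nvar 9) d.k := by
  have hsz := hd.size_lt
  have hk := hd.k_lt_size
  have hk0 := hd.k_pos
  have hK := hd.pow_le_size
  refine Halts.mono (Halts.seq (Halts.nset (Q := fun s' => s'.nvar 11 = 0) (Nat.zero_le _)
    (by simp [NExp.eval])) fun s₁ F₁ h₁ => Halts.seq (Halts.nset
    (Q := fun s' => s'.nvar 12 = 1) (by simp only [NExp.Fits]; omega) (by simp [NExp.eval]))
    fun s₂ F₂ h₂ => (Halts.forLoop (N := d.k) (T := 34)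
      (fun i s' => s'.nvar 11 = clearMask d.ρ (s.nvar 8) (s.nvar 9) i ∧ s'.nvar 12 = 2 ^ i)
      ?_ (by omega) rfl rfl rfl ?_ ?_).conseq fun s' _ h => h.1) (T := 2 + (2 + (d.k * (34 + 8) + 6))) (by omega)
  · rw [F₂.nvar 1 rfl, F₁.nvar 1 rfl, hs.k]
  · simp [F₂.nvar 11 rfl, h₁, h₂, clearMask]
  · rintro i hi s₃ F₃ hi₃ ⟨h11, h12⟩
    have h8 : s₃.nvar 8 = s.nvar 8 := by rw [F₃.nvar 8 rfl, F₂.nvar 8 rfl, F₁.nvar 8 rfl]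
    have h9 : s₃.nvar 9 = s.nvar 9 := by rw [F₃.nvar 9 rfl, F₂.nvar 9 rfl, F₁.nvar 9 rfl]
    have hρ : s₃.narr 1 = d.ρ := by rw [F₃.narr 1 rfl, F₂.narr 1 rfl, F₁.narr 1 rfl, hs.ρ]
    have hpow : 2 ^ i < 2 ^ d.k := Nat.pow_lt_pow_right (by norm_num) hi
    have hcl := clearMask_lt d.ρ (s.nvar 8) (s.nvar 9) i
    refine Halts.mono (Halts.seq (R := fun s' =>
      s'.nvar 11 = clearMask d.ρ (s.nvar 8) (s.nvar 9) (i + 1)) (T := 30) ?_ ?_)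
      (T := 30 + 4) (by omega)
    · refine Halts.mono (Halts.ite (T := 4) ?_ ?_ ?_) (by simp [BExp.cost, NExp.cost])
      · simp only [BExp.Fits, eqTest_fits, NExp.Fits]
        simp
        omega
      · intro hb
        refine Halts.nset ?_ ?_
        · simp only [NExp.Fits, NExp.eval, h11, h12, true_and]
          omega
        · simp only [BExp.eval, eqTest_eval, NExp.eval, h8, h9, h12, hi₃, hρ] at hb
          simp [NExp.eval, h11, h12, clearMask, Nat.testBit_eq_decide_div_mod_eq, hb]
      · intro hb
        refine (Halts.skip ?_).mono (by norm_num)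
        simp only [BExp.eval, eqTest_eval, NExp.eval, h8, h9, h12, hi₃, hρ] at hb
        simp only [h11, clearMask, Nat.testBit_eq_decide_div_mod_eq, decide_eq_true_eq, ne_eq, if_neg hb,
          add_zero]
    · intro s₄ F₄ h₄
      have h12' : s₄.nvar 12 = 2 ^ i := by rw [F₄.nvar 12 rfl, h12]
      refine Halts.nset ?_ ?_
      · simp only [NExp.Fits, NExp.eval, h12', true_and]
        omega
      · simp [NExp.eval, h₄, h12', pow_succ, mul_two]

end RealRAM

namespace RealRAM

open GroupSteiner

variable {d : Data} {W : ℕ}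

/-! #### Filling the table -/

/-- The index of the entry of the vertex pair held by the integer variables `x` and `y`. -/
def pairExp (x y : ℕ) : NExp := .add (.var y) (.mul (.var 0) (.var x))

lemma pairExp_eval {s : State} (hs : Env d s) (x y : ℕ) :
    (pairExp x y).eval s = s.nvar y + d.n * s.nvar x := by
  simp [pairExp, NExp.eval, hs.n]

lemma pairExp_fits (hd : d.Valid W) {s : State} (hs : Env d s) {x y : ℕ} (hx : s.nvar x < d.n)
    (hy : s.nvar y < d.n) : (pairExp x y).Fits W s := by
  have h1 := pair_lt hx hy
  have h2 := hd.sq_le_size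
  have h3 := hd.size_lt
  simp only [pairExp, NExp.Fits, NExp.eval, hs.n, true_and]
  omega

/-- The recurrence for the table entry with index `j`. -/
def CellOK (d : Data) (D : ℕ → ℝ) (P : ℕ → ℕ) (j q m v : ℕ) : Prop :=
  if q % (2 * d.n + 1) = 0 then
    D j = if clearMask d.ρ v m d.k = 0 ∧ v = q / (2 * d.n + 1) then 0 else d.big
  else
    (∃ u < d.n, (u = v ∨ d.A (v + d.n * u) = 1) ∧
      P j = ((q - 1) * 2 ^ d.k + clearMask d.ρ v m d.k) * d.n + u ∧
      D j = D (((q - 1) * 2 ^ d.k + clearMask d.ρ v m d.k) * d.n + u) + d.ω (v + d.n * u)) ∧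
    ∀ u < d.n, (u = v ∨ d.A (v + d.n * u) = 1) →
      D j ≤ D (((q - 1) * 2 ^ d.k + clearMask d.ρ v m d.k) * d.n + u) + d.ω (v + d.n * u)

/-- The recurrence for the table entry with index `j`, in terms of `j`. -/
def EntryOK (d : Data) (D : ℕ → ℝ) (P : ℕ → ℕ) (j : ℕ) : Prop :=
  CellOK d D P j (j / (d.n * 2 ^ d.k)) (j / d.n % 2 ^ d.k) (j % d.n)

/-- All cells of layer `q - 1` precede those of layer `q`, so filling the table by increasing index
reads only finished cells. -/
lemma prev_cell_lt {n K q c u : ℕ} (hq : 0 < q) (hc : c < K) (hu : u < n) :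
    ((q - 1) * K + c) * n + u < q * (n * K) := by
  obtain ⟨q, rfl⟩ := Nat.exists_eq_succ_of_ne_zero hq.ne'
  calc ((q + 1 - 1) * K + c) * n + u < (q * K + c + 1) * n := by
        rw [Nat.add_sub_cancel, Nat.succ_mul]; omega
    _ ≤ (q * K + K) * n := Nat.mul_le_mul_right _ (by omega)
    _ = (q + 1) * (n * K) := by ring

lemma prev_cell_lt_index {n K j c u : ℕ} (hq : 0 < j / (n * K)) (hc : c < K) (hu : u < n) :
    ((j / (n * K) - 1) * K + c) * n + u < j :=
  (prev_cell_lt hq hc hu).trans_le (Nat.div_mul_le_self _ _)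

/-- The recurrence for `j` looks only at indices up to `j`, so later writes do not spoil it. -/
lemma EntryOK.congr {D D' : ℕ → ℝ} {P P' : ℕ → ℕ} {j : ℕ} (h : EntryOK d D P j)
    (hD : ∀ i ≤ j, D' i = D i) (hP : P' j = P j) : EntryOK d D' P' j := by
  unfold EntryOK CellOK at h ⊢
  rw [hP, hD j le_rfl]
  split_ifs at h ⊢ with h1 h2
  · exact h
  · exact h
  · have hq : 0 < j / (d.n * 2 ^ d.k) := Nat.pos_of_ne_zero fun h0 => h1 (by rw [h0, Nat.zero_mod])
    have hlt : ∀ u < d.n, D' (((j / (d.n * 2 ^ d.k) - 1) * 2 ^ d.k +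
        clearMask d.ρ (j % d.n) (j / d.n % 2 ^ d.k) d.k) * d.n + u) = D _ := fun u hu =>
      hD _ (prev_cell_lt_index hq (clearMask_lt _ _ _ _) hu).le
    obtain ⟨⟨u, hu, h2, h3, h4⟩, h5⟩ := h
    refine ⟨⟨u, hu, h2, h3, by rw [h4, hlt u hu]⟩, fun u hu h => ?_⟩
    rw [hlt u hu]
    exact h5 u hu h

/-- Write an entry for hop bound `0`. -/
def initProg : Prog :=
  .ite (.and (eqTest (.var 11) (.lit 0)) (eqTest (.var 8) (.div (.var 10) (.var 3))))
    (.rput 1 (.var 7) (.lit 0)) (.rput 1 (.var 7) (.var 1))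

/-- Try the neighbour held by variable `15`. -/
def relaxBody : Prog :=
  .ite (.and (eqTest (.get 0 (pairExp 15 8)) (.lit 1))
      (.rle (.add (.get 1 (.add (.var 14) (.var 15))) (.get 0 (pairExp 15 8))) (.get 1 (.var 7))))
    (.seq (.rput 1 (.var 7) (.add (.get 1 (.add (.var 14) (.var 15))) (.get 0 (pairExp 15 8))))
      (.nput 3 (.var 7) (.add (.var 14) (.var 15)))) .skip

/-- Write an entry for a positive hop bound. -/
def stepProg : Prog :=
  .seq (.nset 14 (cellExp (.sub (.var 10) (.lit 1)) (.var 11) (.lit 0)))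
  (.seq (.rput 1 (.var 7) (.get 1 (.add (.var 14) (.var 8))))
  (.seq (.nput 3 (.var 7) (.add (.var 14) (.var 8)))
  (forLoop 15 0 relaxBody)))

/-- Write the entry with the index held by variable `7`. -/
def entryProg : Prog :=
  .seq (.nset 8 (.mod (.var 7) (.var 0)))
  (.seq (.nset 9 (.mod (.div (.var 7) (.var 0)) (.var 2)))
  (.seq (.nset 10 (.div (.var 7) (.mul (.var 0) (.var 2))))
  (.seq clearProg
  (.ite (eqTest (.mod (.var 10) (.var 3)) (.lit 0)) initProg stepProg))))

lemma initProg_halts {s : State} (hs : Env d s) :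
    Halts W initProg s 30 fun s' => (∀ x ≠ s.nvar 7, s'.rarr 1 x = s.rarr 1 x) ∧
      (∀ x ≠ s.nvar 7, s'.narr 3 x = s.narr 3 x) ∧
      s'.rarr 1 (s.nvar 7) =
        if s.nvar 11 = 0 ∧ s.nvar 8 = s.nvar 10 / (2 * d.n + 1) then 0 else d.big := by
  refine (Halts.ite (T := 3) ?_ ?_ ?_).mono (by simp [BExp.cost, NExp.cost])
  · simp [BExp.Fits, NExp.Fits]
  · intro hb
    simp only [BExp.eval, eqTest_eval, NExp.eval, hs.layers] at hb
    refine Halts.rput trivial trivial ⟨fun x hx => ?_, fun x hx => rfl, ?_⟩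
    · simp [NExp.eval, hx]
    · simp [NExp.eval, RExp.eval, hb]
  · intro hb
    simp only [BExp.eval, eqTest_eval, NExp.eval, hs.layers] at hb
    refine Halts.rput trivial trivial ⟨fun x hx => ?_, fun x hx => rfl, ?_⟩
    · simp [NExp.eval, hx]
    · simp [NExp.eval, RExp.eval, hs.big, hb]

lemma stepProg_halts (hd : d.Valid W) {s : State} (hs : Env d s) (hj : s.nvar 7 < d.size)
    (hv : s.nvar 8 < d.n) (hc : s.nvar 11 < 2 ^ d.k) (hq : 0 < s.nvar 10)
    (hqj : s.nvar 10 * (d.n * 2 ^ d.k) ≤ s.nvar 7) :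
    Halts W stepProg s (58 * d.n + 50) fun s' => (∀ x ≠ s.nvar 7, s'.rarr 1 x = s.rarr 1 x) ∧
      (∀ x ≠ s.nvar 7, s'.narr 3 x = s.narr 3 x) ∧
      (∃ u < d.n, (u = s.nvar 8 ∨ d.A (s.nvar 8 + d.n * u) = 1) ∧
        s'.narr 3 (s.nvar 7) = ((s.nvar 10 - 1) * 2 ^ d.k + s.nvar 11) * d.n + u ∧
        s'.rarr 1 (s.nvar 7) = s.rarr 1 (((s.nvar 10 - 1) * 2 ^ d.k + s.nvar 11) * d.n + u) +
          d.ω (s.nvar 8 + d.n * u)) ∧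
      ∀ u < d.n, (u = s.nvar 8 ∨ d.A (s.nvar 8 + d.n * u) = 1) →
        s'.rarr 1 (s.nvar 7) ≤ s.rarr 1 (((s.nvar 10 - 1) * 2 ^ d.k + s.nvar 11) * d.n + u) +
          d.ω (s.nvar 8 + d.n * u) := by
  have hsz := hd.size_lt
  have hn0 := hd.n_pos
  have hns := hd.hops_lt_size
  set j := s.nvar 7 with hjdef
  set v := s.nvar 8 with hvdef
  set b := ((s.nvar 10 - 1) * 2 ^ d.k + s.nvar 11) * d.n with hb
  -- Every cell that is read lies strictly below `j`, so cell `j` can serve as the running minimum.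
  -- It starts from the choice `u = v`.
  have hblt : ∀ u < d.n, b + u < j := fun u hu => (prev_cell_lt hq hc hu).trans_le hqj
  have hbv := hblt v hv
  refine Halts.mono (Halts.seq (Halts.nset (Q := fun s' => s'.nvar 14 = b) ?_ ?_)
    fun s₁ F₁ h₁ => Halts.seq (Halts.rput (Q := fun s' => (∀ x ≠ j, s'.rarr 1 x = s.rarr 1 x) ∧
      s'.rarr 1 j = s.rarr 1 (b + v)) trivial ?_ ?_)
    fun s₂ F₂ h₂ => Halts.seq (Halts.nput (Q := fun s' => (∀ x ≠ j, s'.narr 3 x = s.narr 3 x) ∧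
      s'.narr 3 j = b + v) trivial ?_ ?_)
    fun s₃ F₃ h₃ => (Halts.forLoop (N := d.n) (T := 50)
      (fun i s' => (∀ x ≠ j, s'.rarr 1 x = s.rarr 1 x) ∧ (∀ x ≠ j, s'.narr 3 x = s.narr 3 x) ∧
        (∃ u < d.n, (u = v ∨ d.A (v + d.n * u) = 1) ∧ s'.narr 3 j = b + u ∧
          s'.rarr 1 j = s.rarr 1 (b + u) + d.ω (v + d.n * u)) ∧
        s'.rarr 1 j ≤ s.rarr 1 (b + v) ∧
        ∀ u < i, d.A (v + d.n * u) = 1 → s'.rarr 1 j ≤ s.rarr 1 (b + u) + d.ω (v + d.n * u))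
      ?_ (by omega) rfl rfl rfl ?_ ?_).conseq ?_)
    (T' := 58 * d.n + 50) (by
      simp only [cellExp, NExp.cost, RExp.cost]; omega)
  · refine cellExp_fits hd hs ⟨trivial, ?_⟩ trivial (Nat.zero_le _) ?_ hc hn0
    · change 1 ≤ W; omega
    · change s.nvar 10 - 1 < _
      have h1 : s.nvar 10 * (d.n * 2 ^ d.k) < d.n * (2 * d.n + 1) * (d.n * 2 ^ d.k) := by
        refine hqj.trans_lt (hj.trans_eq ?_)
        rw [Data.size]; ring
      have := Nat.lt_of_mul_lt_mul_right h1
      omega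
  · simp [cellExp_eval hs, NExp.eval, hb]
  · simp only [RExp.Fits, NExp.Fits, NExp.eval, true_and, h₁, F₁.nvar 8 rfl]
    omega
  · have h7 : s₁.nvar 7 = j := F₁.nvar 7 rfl
    have h8 : s₁.nvar 8 = v := F₁.nvar 8 rfl
    simp only [NExp.eval, RExp.eval, h7, h8, h₁, F₁.rarr 1 rfl, Function.update_self]
    exact ⟨fun x hx => by simp [hx], trivial⟩
  · simp only [NExp.Fits, NExp.eval, true_and, F₂.nvar 14 rfl, h₁, F₂.nvar 8 rfl, F₁.nvar 8 rfl]
    omega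
  · have h7 : s₂.nvar 7 = j := (F₂.nvar 7 rfl).trans (F₁.nvar 7 rfl)
    have h8 : s₂.nvar 8 = v := (F₂.nvar 8 rfl).trans (F₁.nvar 8 rfl)
    simp only [NExp.eval, h7, h8, F₂.nvar 14 rfl, h₁, F₂.narr 3 rfl, F₁.narr 3 rfl,
      Function.update_self]
    exact ⟨fun x hx => by simp [hx], trivial⟩
  · rw [F₃.nvar 0 rfl, F₂.nvar 0 rfl, F₁.nvar 0 rfl, hs.n]
  · simp only [F₃.rarr 1 rfl]
    refine ⟨h₂.1, h₃.1, ⟨v, hv, Or.inl rfl, h₃.2, ?_⟩, h₂.2.le, fun u hu => absurd hu (by omega)⟩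
    rw [hd.ω_self v hv, add_zero, h₂.2]
  · rintro i hi s₄ F₄ h15 ⟨hD, hP, hex, hle, hall⟩
    have h7 : s₄.nvar 7 = j := by rw [F₄.nvar 7 rfl, F₃.nvar 7 rfl, F₂.nvar 7 rfl, F₁.nvar 7 rfl]
    have h8 : s₄.nvar 8 = v := by rw [F₄.nvar 8 rfl, F₃.nvar 8 rfl, F₂.nvar 8 rfl, F₁.nvar 8 rfl]
    have h14 : s₄.nvar 14 = b := by rw [F₄.nvar 14 rfl, F₃.nvar 14 rfl, F₂.nvar 14 rfl, h₁]
    have hs₄ : Env d s₄ := (((hs.of_frame (by decide) F₁).of_frame (by decide) F₂).of_frame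
      (by decide) F₃).of_frame (by decide) F₄
    have hbi := hblt i hi
    have hpair : (pairExp 15 8).Fits W s₄ := pairExp_fits hd hs₄ (by rw [h15]; exact hi)
      (by rw [h8]; exact hv)
    have hbF : (NExp.add (.var 14) (.var 15)).Fits W s₄ := by
      simp only [NExp.Fits, NExp.eval, h14, h15, true_and]; omega
    refine (Halts.ite (T := 18) ?_ ?_ ?_).mono
      (by simp [BExp.cost, NExp.cost, RExp.cost, pairExp])
    · simp only [BExp.Fits, eqTest_fits, NExp.Fits, RExp.Fits]
      exact ⟨⟨hpair, by omega⟩, ⟨hbF, hpair⟩, trivial⟩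
    · intro ht
      simp only [BExp.eval, eqTest_eval, NExp.eval, RExp.eval, pairExp_eval hs₄, h15, h8, h14, h7,
        hs₄.A, hs₄.ω, hD _ hbi.ne] at ht
      refine Halts.mono (Halts.seq (Halts.rput (Q := fun s' => (∀ x ≠ j, s'.rarr 1 x = s.rarr 1 x) ∧
        s'.rarr 1 j = s.rarr 1 (b + i) + d.ω (v + d.n * i)) trivial ⟨hbF, hpair⟩ ?_)
        fun s₅ F₅ h₅ => Halts.nput trivial ?_ ?_) (by simp [NExp.cost, RExp.cost, pairExp])
      · simp only [NExp.eval, RExp.eval, pairExp_eval hs₄, h15, h8, h14, h7, hs₄.ω, hD _ hbi.ne,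
          Function.update_self]
        exact ⟨fun x hx => by simp [hx, hD x hx], trivial⟩
      · simp only [NExp.Fits, NExp.eval, F₅.nvar 14 rfl, F₅.nvar 15 rfl, h14, h15, true_and]
        omega
      · simp only [NExp.eval, F₅.nvar 14 rfl, F₅.nvar 15 rfl, F₅.nvar 7 rfl, h14, h15, h7,
          F₅.narr 3 rfl, Function.update_self]
        refine ⟨h₅.1, fun x hx => by simp [hx, hP x hx], ⟨i, hi, Or.inr ht.1, rfl, h₅.2⟩, ?_, ?_⟩
        · rw [h₅.2]; exact ht.2.trans hle
        · intro u hu hA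
          rcases Nat.lt_succ_iff_lt_or_eq.1 hu with hu | rfl
          · rw [h₅.2]; exact ht.2.trans (hall u hu hA)
          · exact h₅.2.le
    · intro ht
      simp only [BExp.eval, eqTest_eval, NExp.eval, RExp.eval, pairExp_eval hs₄, h15, h8, h14, h7,
        hs₄.A, hs₄.ω, hD _ hbi.ne] at ht
      refine (Halts.skip ?_).mono (by norm_num)
      refine ⟨hD, hP, hex, hle, fun u hu hA => ?_⟩
      rcases Nat.lt_succ_iff_lt_or_eq.1 hu with hu | rfl
      · exact hall u hu hA
      · exact (not_le.1 fun h => ht ⟨hA, h⟩).le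
  · rintro s₄ - ⟨hD, hP, hex, hle, hall⟩
    refine ⟨hD, hP, hex, fun u hu h => ?_⟩
    rcases h with rfl | h
    · rw [hd.ω_self _ hu, add_zero]; exact hle
    · exact hall u hu h

/-- Layer, mask and vertex are decoded from the index by division. As `k, n ≥ 1`, the bound `210 k
n` absorbs `52 k` steps for the mask, `58 n` for the neighbours and the constants. -/
lemma entryProg_halts (hd : d.Valid W) {s : State} (hs : Env d s) (hj : s.nvar 7 < d.size) :
    Halts W entryProg s (210 * (d.k * d.n)) fun s' =>
      (∀ x ≠ s.nvar 7, s'.rarr 1 x = s.rarr 1 x) ∧ (∀ x ≠ s.nvar 7, s'.narr 3 x = s.narr 3 x) ∧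
      EntryOK d (s'.rarr 1) (s'.narr 3) (s.nvar 7) := by
  have hsz := hd.size_lt
  have hn0 := hd.n_pos
  have hk0 := hd.k_pos
  have hnK := hd.mul_pow_le_size
  have hkn1 : d.k ≤ d.k * d.n := Nat.le_mul_of_pos_right _ hn0
  have hkn2 : d.n ≤ d.k * d.n := Nat.le_mul_of_pos_left _ hk0
  set j := s.nvar 7 with hjdef
  refine Halts.mono (Halts.seq (Halts.nset (Q := fun s' => s'.nvar 8 = j % d.n) ⟨trivial, trivial⟩
      (by simp [NExp.eval, hs.n, hjdef]))
    fun s₁ F₁ h₁ => Halts.seq (Halts.nset (Q := fun s' => s'.nvar 9 = j / d.n % 2 ^ d.k)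
      ⟨⟨trivial, trivial⟩, trivial⟩ ?_)
    fun s₂ F₂ h₂ => Halts.seq (Halts.nset (Q := fun s' => s'.nvar 10 = j / (d.n * 2 ^ d.k)) ?_ ?_)
    fun s₃ F₃ h₃ => Halts.seq (clearProg_halts hd ?_)
    fun s₄ F₄ h₄ => Halts.ite (T := 58 * d.n + 50) ?_ ?_ ?_)
    (T' := 210 * (d.k * d.n)) (by simp only [NExp.cost, eqTest_cost]; omega)
  · simp [NExp.eval, F₁.nvar 7 rfl, F₁.nvar 0 rfl, F₁.nvar 2 rfl, hs.n, hs.K, hjdef]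
  · simp only [NExp.Fits, NExp.eval, F₂.nvar 0 rfl, F₂.nvar 2 rfl, F₁.nvar 0 rfl, F₁.nvar 2 rfl,
      hs.n, hs.K, true_and]
    omega
  · simp [NExp.eval, F₂.nvar 0 rfl, F₂.nvar 2 rfl, F₁.nvar 0 rfl, F₁.nvar 2 rfl, F₂.nvar 7 rfl,
      F₁.nvar 7 rfl, hs.n, hs.K, hjdef]
  · exact ((hs.of_frame (by decide) F₁).of_frame (by decide) F₂).of_frame (by decide) F₃
  · simp [NExp.Fits]
  all_goals
    have hs₄ : Env d s₄ := (((hs.of_frame (by decide) F₁).of_frame (by decide) F₂).of_frame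
      (by decide) F₃).of_frame (by decide) F₄
    have h7 : s₄.nvar 7 = j := by rw [F₄.nvar 7 rfl, F₃.nvar 7 rfl, F₂.nvar 7 rfl, F₁.nvar 7 rfl]
    have h10 : s₄.nvar 10 = j / (d.n * 2 ^ d.k) := by rw [F₄.nvar 10 rfl, h₃]
    have h83 : s₃.nvar 8 = j % d.n := by rw [F₃.nvar 8 rfl, F₂.nvar 8 rfl, h₁]
    have h8 : s₄.nvar 8 = j % d.n := by rw [F₄.nvar 8 rfl, h83]
    have hr : s₄.rarr 1 = s.rarr 1 := by
      rw [F₄.rarr 1 rfl, F₃.rarr 1 rfl, F₂.rarr 1 rfl, F₁.rarr 1 rfl]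
    have hp : s₄.narr 3 = s.narr 3 := by
      rw [F₄.narr 3 rfl, F₃.narr 3 rfl, F₂.narr 3 rfl, F₁.narr 3 rfl]
    rw [h83, F₃.nvar 9 rfl, h₂] at h₄
    intro hb
    rw [eqTest_eval] at hb
    simp only [NExp.eval, h10, hs₄.layers] at hb
  · refine ((initProg_halts hs₄).mono (by omega)).conseq ?_
    rintro s₅ - ⟨hD, hP, hval⟩
    rw [h7, h₄, h8, h10] at hval
    rw [h7] at hD hP
    refine ⟨fun x hx => by rw [hD x hx, hr], fun x hx => by rw [hP x hx, hp], ?_⟩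
    rw [EntryOK, CellOK, if_pos hb, hval]
  · have hq : 0 < j / (d.n * 2 ^ d.k) := Nat.pos_of_ne_zero fun h0 => hb (by rw [h0, Nat.zero_mod])
    refine (stepProg_halts hd hs₄ (by rw [h7]; exact hj) (by rw [h8]; exact Nat.mod_lt _ hn0)
      (by rw [h₄]; exact clearMask_lt _ _ _ _) (by rw [h10]; exact hq)
      (by rw [h10, h7]; exact Nat.div_mul_le_self _ _)).conseq ?_
    rintro s₅ - ⟨hD, hP, hex, hall⟩
    rw [h7] at hD hP
    simp only [h7, h₄, h8, h10] at hex hall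
    have hlt : ∀ u < d.n, s₅.rarr 1 (((j / (d.n * 2 ^ d.k) - 1) * 2 ^ d.k +
        clearMask d.ρ (j % d.n) (j / d.n % 2 ^ d.k) d.k) * d.n + u) = s₄.rarr 1 _ := fun u hu =>
      hD _ (prev_cell_lt_index hq (clearMask_lt _ _ _ _) hu).ne
    refine ⟨fun x hx => by rw [hD x hx, hr], fun x hx => by rw [hP x hx, hp], ?_⟩
    rw [EntryOK, CellOK, if_neg hb]
    obtain ⟨u, hu, h1, h2, h3⟩ := hex
    refine ⟨⟨u, hu, h1, h2, by rw [h3, hlt u hu]⟩, fun u hu h => ?_⟩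
    rw [hlt u hu]
    exact hall u hu h

/-- Fill the table. -/
def fillProg : Prog := forLoop 7 6 entryProg

lemma fillProg_halts (hd : d.Valid W) {s : State} (hs : Env d s) :
    Halts W fillProg s (d.size * (210 * (d.k * d.n) + 8) + 6) fun s' =>
      ∀ j < d.size, EntryOK d (s'.rarr 1) (s'.narr 3) j := by
  have hsz := hd.size_lt
  refine Halts.forLoop (fun i s' => ∀ j < i, EntryOK d (s'.rarr 1) (s'.narr 3) j) hs.size
    (by omega) rfl rfl rfl (fun j hj => absurd hj (by omega)) ?_
  rintro i hi s₁ F₁ h7 hI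
  refine (entryProg_halts hd (hs.of_frame (by decide) F₁) (by rw [h7]; exact hi)).conseq ?_
  rintro s₂ - ⟨hD, hP, hok⟩
  rw [h7] at hD hP hok
  intro j hj
  rcases Nat.lt_succ_iff_lt_or_eq.1 hj with hj | rfl
  · exact (hI j hj).congr (fun x hx => hD x (by omega)) (hP j (by omega))
  · exact hok

end RealRAM

namespace RealRAM

open GroupSteiner

variable {d : Data} {W : ℕ}

/-- The input and the table with values `D` and pointers `P` are in place. -/
structure TableEnv (d : Data) (D : ℕ → ℝ) (P : ℕ → ℕ) (s : State) : Prop extends Env d s where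
  D : s.rarr 1 = D
  P : s.narr 3 = P

variable {D : ℕ → ℝ} {P : ℕ → ℕ}

lemma TableEnv.of_frame {p : Prog} {s s' : State} (h : TableEnv d D P s)
    (hp : p.KeepsEnv ∧ p.putsR 1 = false ∧ p.putsN 3 = false)
    (hF : Frame p s s') : TableEnv d D P s' :=
  ⟨h.toEnv.of_frame hp.1 hF, by rw [hF.rarr 1 hp.2.1, h.D], by rw [hF.narr 3 hp.2.2, h.P]⟩

/-! #### The smallest group Steiner distance -/

/-- The index of the final entry for the sources and vertices held by variables `7` and `8` and
the full mask. -/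
def fullExp : NExp := indexExp (.var 7) (.var 4) (.sub (.var 2) (.lit 1)) (.var 8)

lemma fullExp_eval {s : State} (hs : Env d s) : fullExp.eval s =
    tableIndex d.n d.k (s.nvar 7) (2 * d.n) (2 ^ d.k - 1) (s.nvar 8) := by
  simp [fullExp, indexExp_eval hs, NExp.eval, hs.hops, hs.K]

lemma fullExp_fits (hd : d.Valid W) {s : State} (hs : Env d s) (h7 : s.nvar 7 < d.n)
    (h8 : s.nvar 8 < d.n) : fullExp.Fits W s := by
  have h2k : 0 < 2 ^ d.k := by positivity
  have := hd.size_lt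
  refine indexExp_fits hd hs trivial trivial ⟨trivial, ?_⟩ trivial h7 hs.hops.le ?_ h8
  · change 1 ≤ W; omega
  · simp only [NExp.eval, hs.K]; omega

/-- Compute the smallest group Steiner distance in real variable `3`. -/
def minProg : Prog :=
  .seq (.rset 3 (.var 1)) (forLoop 7 0 (forLoop 8 0
    (.ite (.rle (.get 1 fullExp) (.var 3)) (.rset 3 (.get 1 fullExp)) .skip)))

/-- The alternative `big` is the start value of the running minimum; it is excluded later, since
final entries lie below `big`. -/
lemma minProg_halts (hd : d.Valid W) {s : State} (hs : TableEnv d D P s) :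
    Halts W minProg s (d.n * (d.n * 43 + 6 + 8) + 8) fun s' =>
      (∀ a < d.n, ∀ b < d.n,
        s'.rvar 3 ≤ D (tableIndex d.n d.k a (2 * d.n) (2 ^ d.k - 1) b)) ∧
      (s'.rvar 3 = d.big ∨ ∃ a < d.n, ∃ b < d.n,
        s'.rvar 3 = D (tableIndex d.n d.k a (2 * d.n) (2 ^ d.k - 1) b)) := by
  have hsz := hd.size_lt
  have hns := hd.hops_lt_size
  set f : ℕ → ℕ → ℝ := fun a b => D (tableIndex d.n d.k a (2 * d.n) (2 ^ d.k - 1) b) with hf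
  refine Halts.mono (Halts.seq (Halts.rset (Q := fun s' => s'.rvar 3 = d.big) trivial
      (by simp [RExp.eval, hs.big]))
    fun s₁ F₁ h₁ => Halts.forLoop (N := d.n) (T := d.n * 43 + 6)
      (fun i s' => (∀ a < i, ∀ b < d.n, s'.rvar 3 ≤ f a b) ∧
        (s'.rvar 3 = d.big ∨ ∃ a < d.n, ∃ b < d.n, s'.rvar 3 = f a b))
      ?_ (by omega) rfl rfl rfl ?_ ?_) (T' := d.n * (d.n * 43 + 6 + 8) + 8)
    (by simp only [RExp.cost]; omega)
  · rw [F₁.nvar 0 rfl, hs.n]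
  · exact ⟨fun a ha => absurd ha (by omega), Or.inl h₁⟩
  · rintro i hi s₂ F₂ h7 ⟨hle, hex⟩
    have hs₂ := (hs.of_frame (by decide) F₁).of_frame (by decide) F₂
    refine (Halts.forLoop (N := d.n) (T := 35)
      (fun j s' => (∀ a < i, ∀ b < d.n, s'.rvar 3 ≤ f a b) ∧ (∀ b < j, s'.rvar 3 ≤ f i b) ∧
        (s'.rvar 3 = d.big ∨ ∃ a < d.n, ∃ b < d.n, s'.rvar 3 = f a b))
      hs₂.n (by omega) rfl rfl rfl ⟨hle, fun b hb => absurd hb (by omega), hex⟩ ?_).conseq ?_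
    · rintro j hj s₃ F₃ h8 ⟨hle, hle', hex⟩
      have hs₃ := hs₂.of_frame (by decide) F₃
      have h7' : s₃.nvar 7 = i := (F₃.nvar 7 rfl).trans h7
      have hfit : fullExp.Fits W s₃ := fullExp_fits hd hs₃.toEnv (by omega) (by omega)
      refine (Halts.ite (T := 17) ?_ ?_ ?_).mono
        (by simp [BExp.cost, RExp.cost, NExp.cost, fullExp, indexExp, cellExp])
      · exact ⟨hfit, trivial⟩
      · intro ht
        simp only [BExp.eval, RExp.eval, fullExp_eval hs₃.toEnv, hs₃.D, h7', h8] at ht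
        refine Halts.rset hfit ?_
        simp only [RExp.eval, fullExp_eval hs₃.toEnv, hs₃.D, h7', h8, Function.update_self]
        refine ⟨fun a ha b hb => ht.trans (hle a ha b hb), fun b hb => ?_,
          Or.inr ⟨i, hi, j, hj, rfl⟩⟩
        rcases Nat.lt_succ_iff_lt_or_eq.1 hb with hb | rfl
        exacts [ht.trans (hle' b hb), le_rfl]
      · intro ht
        simp only [BExp.eval, RExp.eval, fullExp_eval hs₃.toEnv, hs₃.D, h7', h8] at ht
        refine (Halts.skip ?_).mono (by norm_num)
        refine ⟨hle, fun b hb => ?_, hex⟩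
        rcases Nat.lt_succ_iff_lt_or_eq.1 hb with hb | rfl
        exacts [hle' b hb, (not_le.1 ht).le]
    · rintro s₃ - ⟨hle, hle', hex⟩
      refine ⟨fun a ha b hb => ?_, hex⟩
      rcases Nat.lt_succ_iff_lt_or_eq.1 ha with ha | rfl
      exacts [hle a ha b hb, hle' b hb]

/-! #### The net of terminals -/

/-- The test whether the terminal with index in variable `13` is close to the net point
in variable `8`. -/
def closeTest : BExp :=
  .and (eqTest (.get 4 (.var 8)) (.lit 1))
    (.rle (.mul (.lit 4) (.get 1 (indexExp (.var 8) (.var 4) (.lit 0) (.get 1 (.var 13)))))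
      (.mul (.var 0) (.var 3)))

/-- Consider the terminal with index in variable `13` for the net. -/
def netBody : Prog :=
  .seq (.nset 17 (.lit 1))
  (.seq (forLoop 8 0 (.ite closeTest (.nset 17 (.lit 0)) .skip))
  (.ite (eqTest (.var 17) (.lit 1)) (.nput 4 (.get 1 (.var 13)) (.lit 1)) .skip))

/-- Choose a net of the terminals greedily, and mark its points in integer array `4`. -/
def netProg : Prog := forLoop 13 1 netBody

/-- `M` marks a set of terminals such that any two of them are more than `ε L / 4` apart and
each of the first `i` terminals has one of them within that distance. -/
structure IsNet (d : Data) (D : ℕ → ℝ) (L : ℝ) (M : ℕ → ℕ) (i : ℕ) : Prop where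
  terminal : ∀ x, M x = 1 → ∃ j < d.k, x = d.ρ j
  -- The table is not shown to be symmetric in source and vertex. Only the older net point is tested
  -- as the source, hence the disjunction.
  sep : ∀ x, M x = 1 → ∀ y, M y = 1 → x ≠ y →
    d.ε * L < 4 * D (tableIndex d.n d.k x (2 * d.n) 0 y) ∨
    d.ε * L < 4 * D (tableIndex d.n d.k y (2 * d.n) 0 x)
  cover : ∀ j < i, ∃ x, M x = 1 ∧ 4 * D (tableIndex d.n d.k x (2 * d.n) 0 (d.ρ j)) ≤ d.ε * L

lemma netBody_halts (hd : d.Valid W) {s : State} (hs : TableEnv d D P s) {i : ℕ} (hi : i < d.k)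
    (h13 : s.nvar 13 = i) (hI : IsNet d D (s.rvar 3) (s.narr 4) i)
    (hself : 4 * D (tableIndex d.n d.k (d.ρ i) (2 * d.n) 0 (d.ρ i)) ≤ d.ε * s.rvar 3) :
    Halts W netBody s (d.n * 48 + 24) fun s' => IsNet d D (s.rvar 3) (s'.narr 4) (i + 1) := by
  have hsz := hd.size_lt
  have hns := hd.hops_lt_size
  set L := s.rvar 3 with hLdef
  set M := s.narr 4 with hMdef
  set f : ℕ → ℝ := fun v => D (tableIndex d.n d.k v (2 * d.n) 0 (d.ρ i)) with hf
  refine Halts.mono (Halts.seq (Halts.nset (Q := fun s' => s'.nvar 17 = 1)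
      (by simp only [NExp.Fits]; omega) (by simp [NExp.eval]))
    fun s₁ F₁ h₁ => Halts.seq (Halts.forLoop (N := d.n) (T := 40)
      (fun v s' => (s'.nvar 17 = 1 ∧ ∀ x < v, M x = 1 → d.ε * L < 4 * f x) ∨
        (s'.nvar 17 = 0 ∧ ∃ x, M x = 1 ∧ 4 * f x ≤ d.ε * L))
      ?_ (by omega) rfl rfl rfl ?_ ?_)
    fun s₂ F₂ h₂ => Halts.ite (T := 4) ?_ ?_ ?_) (T' := d.n * 48 + 24)
    (by simp only [NExp.cost, eqTest_cost]; omega)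
  · rw [F₁.nvar 0 rfl, hs.n]
  · exact Or.inl ⟨by simpa using h₁, fun x hx => absurd hx (by omega)⟩
  · rintro v hv s₂ F₂ h8 hI₂
    have hs₂ := (hs.of_frame (by decide) F₁).of_frame (by decide) F₂
    have h13' : s₂.nvar 13 = i := by rw [F₂.nvar 13 rfl, F₁.nvar 13 rfl, h13]
    have hL : s₂.rvar 3 = L := by rw [F₂.rvar 3 rfl, F₁.rvar 3 rfl]
    have hM : s₂.narr 4 = M := by rw [F₂.narr 4 rfl, F₁.narr 4 rfl]
    have hev : closeTest.eval s₂ ↔ M v = 1 ∧ 4 * f v ≤ d.ε * L := by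
      simp only [closeTest, BExp.eval, eqTest_eval, NExp.eval, RExp.eval,
        indexExp_eval hs₂.toEnv, hs₂.hops, hs₂.ρ, hs₂.D, hs₂.ε, h8, h13', hL, hM, hf, Nat.cast_ofNat]
    refine (Halts.ite (T := 2) ?_ ?_ ?_).mono
      (by simp [closeTest, BExp.cost, RExp.cost, NExp.cost, indexExp, cellExp])
    · have h2k : 0 < 2 ^ d.k := by positivity
      simp only [closeTest, BExp.Fits, eqTest_fits, NExp.Fits, RExp.Fits, true_and, and_true]
      refine ⟨by omega, indexExp_fits hd hs₂.toEnv trivial trivial (Nat.zero_le _) trivial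
        (by simpa only [NExp.eval, h8]) hs₂.hops.le h2k ?_⟩
      simp only [NExp.eval, hs₂.ρ, h13']
      exact hd.ρ_lt i hi
    · intro ht
      refine Halts.nset ?_ ?_
      · exact Nat.zero_le _
      exact Or.inr ⟨by simp [NExp.eval], v, hev.1 ht⟩
    · intro ht
      refine (Halts.skip ?_).mono (by norm_num)
      rcases hI₂ with ⟨h17, hall⟩ | ⟨h17, hex⟩
      · refine Or.inl ⟨by simpa using h17, fun x hx hMx => ?_⟩
        rcases Nat.lt_succ_iff_lt_or_eq.1 hx with hx | rfl
        · exact hall x hx hMx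
        · exact not_le.1 fun h => ht (hev.2 ⟨hMx, h⟩)
      · exact Or.inr ⟨by simpa using h17, hex⟩
  · simp only [eqTest_fits, NExp.Fits, true_and]; omega
  all_goals
    have hM : s₂.narr 4 = M := by rw [F₂.narr 4 rfl, F₁.narr 4 rfl]
    have h13' : s₂.nvar 13 = i := by rw [F₂.nvar 13 rfl, F₁.nvar 13 rfl, h13]
    have hρ : s₂.narr 1 = d.ρ := by rw [F₂.narr 1 rfl, F₁.narr 1 rfl, hs.ρ]
    intro ht
    simp only [eqTest_eval, NExp.eval] at ht
  · obtain ⟨-, hall⟩ := h₂.resolve_right fun h => by omega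
    refine Halts.nput trivial (by simp only [NExp.Fits]; omega) ?_
    simp only [NExp.eval, hρ, h13', hM, Function.update_self]
    have hρi := hd.ρ_lt i hi
    -- Marked points are terminals, hence below `n`, so the loop has inspected all of them.
    have hlt : ∀ x, M x = 1 → d.ε * L < 4 * f x := fun x hx => by
      obtain ⟨j, hj, rfl⟩ := hI.terminal x hx
      exact hall _ (hd.ρ_lt j hj) hx
    have hup : ∀ x, Function.update M (d.ρ i) 1 x = 1 ↔ x = d.ρ i ∨ M x = 1 := fun x => by
      by_cases hx : x = d.ρ i <;> simp [hx]
    refine ⟨fun x hx => ?_, fun x hx y hy hxy => ?_, fun j hj => ?_⟩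
    · rcases (hup x).1 hx with rfl | hx
      exacts [⟨i, hi, rfl⟩, hI.terminal x hx]
    · rcases (hup x).1 hx with rfl | hx <;> rcases (hup y).1 hy with rfl | hy
      · exact absurd rfl hxy
      · exact Or.inr (hlt y hy)
      · exact Or.inl (hlt x hx)
      · exact hI.sep x hx y hy hxy
    · rcases Nat.lt_succ_iff_lt_or_eq.1 hj with hj | rfl
      · obtain ⟨x, hx, h⟩ := hI.cover j hj
        exact ⟨x, (hup x).2 (Or.inr hx), h⟩
      · exact ⟨d.ρ j, (hup _).2 (Or.inl rfl), hself⟩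
  · refine (Halts.skip ?_).mono (by norm_num)
    obtain ⟨-, hex⟩ := h₂.resolve_left fun h => ht h.1
    rw [hM]
    refine ⟨hI.terminal, hI.sep, fun j hj => ?_⟩
    rcases Nat.lt_succ_iff_lt_or_eq.1 hj with hj | rfl
    exacts [hI.cover j hj, hex]

lemma netProg_halts (hd : d.Valid W) {s : State} (hs : TableEnv d D P s)
    (h4 : s.narr 4 = fun _ => 0)
    (hself : ∀ i < d.k,
      4 * D (tableIndex d.n d.k (d.ρ i) (2 * d.n) 0 (d.ρ i)) ≤ d.ε * s.rvar 3) :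
    Halts W netProg s (d.k * (d.n * 48 + 24 + 8) + 6) fun s' =>
      IsNet d D (s.rvar 3) (s'.narr 4) d.k := by
  have hsz := hd.size_lt
  have hks := hd.k_lt_size
  refine Halts.forLoop (fun i s' => IsNet d D (s.rvar 3) (s'.narr 4) i) hs.k
    (by omega) rfl rfl rfl ?_ ?_
  · simp only [h4]
    exact ⟨fun _ h => absurd h (by norm_num), fun _ h => absurd h (by norm_num),
      fun _ h => absurd h (by omega)⟩
  · intro i hi s₁ F₁ h13 hI
    have hL := F₁.rvar 3 rfl
    rw [← hL] at hI hself ⊢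
    exact netBody_halts hd (hs.of_frame (by decide) F₁) hi h13 hI (hself i hi)

/-! #### Marking the edges -/

/-- Integer array `2` holds the adjacency matrix of the graph with the edges in `E`. -/
def Marked (d : Data) (E : Finset (Sym2 ℕ)) (s : State) : Prop :=
  ∀ u < d.n, ∀ v < d.n, s.narr 2 (v + d.n * u) = if s(u, v) ∈ E then d.A (v + d.n * u) else 0

/-- Mark the edge from the vertex of the entry in variable `16` to that of its successor. -/
def markProg : Prog :=
  .seq (.nset 18 (.mod (.var 16) (.var 0)))
  (.seq (.nset 19 (.mod (.get 3 (.var 16)) (.var 0)))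
  (.seq (.nput 2 (pairExp 18 19) (.get 0 (pairExp 18 19)))
  (.nput 2 (pairExp 19 18) (.get 0 (pairExp 19 18)))))

lemma pair_inj {n u v u' v' : ℕ} (hv : v < n) (hv' : v' < n) :
    v + n * u = v' + n * u' ↔ u = u' ∧ v = v' := by
  constructor
  · intro h
    have h1 := congrArg (· % n) h
    simp only [Nat.add_mul_mod_self_left, Nat.mod_eq_of_lt hv, Nat.mod_eq_of_lt hv'] at h1
    subst h1
    exact ⟨Nat.eq_of_mul_eq_mul_left (by omega) (Nat.add_left_cancel h), rfl⟩
  · rintro ⟨rfl, rfl⟩; rfl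

/-- Copying the entry of the input matrix, instead of writing `1`, leaves non-edges of the graph
unmarked. Both orientations are written to keep the matrix symmetric. -/
lemma markProg_halts (hd : d.Valid W) {s : State} (hs : TableEnv d D P s) {E : Finset (Sym2 ℕ)}
    (hE : Marked d E s) :
    Halts W markProg s 33 (Marked d (insert (entryEdge d.n P (s.nvar 16)) E)) := by
  set a := s.nvar 16 % d.n with ha
  set b := P (s.nvar 16) % d.n with hb
  have ha' : a < d.n := Nat.mod_lt _ hd.n_pos
  have hb' : b < d.n := Nat.mod_lt _ hd.n_pos
  refine Halts.mono (Halts.seq (Halts.nset (Q := fun s' => s'.nvar 18 = a) ⟨trivial, trivial⟩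
      (by simp [NExp.eval, hs.n, ha]))
    fun s₁ F₁ h₁ => Halts.seq (Halts.nset (Q := fun s' => s'.nvar 19 = b) ⟨trivial, trivial⟩ ?_)
    fun s₂ F₂ h₂ => Halts.seq (Halts.nput (Q := fun s' => s'.narr 2 =
      Function.update (s.narr 2) (b + d.n * a) (d.A (b + d.n * a))) ?_ ?_ ?_)
    fun s₃ F₃ h₃ => Halts.nput ?_ ?_ ?_) (T' := 33) (by simp [NExp.cost, pairExp])
  · have := (hs.of_frame (by decide) F₁)
    simp [NExp.eval, F₁.nvar 16 rfl, this.n, this.P, hb]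
  · have hs₂ := (hs.of_frame (by decide) F₁).of_frame (by decide) F₂
    exact pairExp_fits hd hs₂.toEnv (by rw [F₂.nvar 18 rfl, h₁]; exact ha') (by rw [h₂]; exact hb')
  · have hs₂ := (hs.of_frame (by decide) F₁).of_frame (by decide) F₂
    exact pairExp_fits hd hs₂.toEnv (by rw [F₂.nvar 18 rfl, h₁]; exact ha') (by rw [h₂]; exact hb')
  · have hs₂ := (hs.of_frame (by decide) F₁).of_frame (by decide) F₂
    simp [pairExp_eval hs₂.toEnv, NExp.eval, h₂, F₂.nvar 18 rfl, h₁, hs₂.A, F₂.narr 2 rfl,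
      F₁.narr 2 rfl]
  all_goals
    have hs₃ := ((hs.of_frame (by decide) F₁).of_frame (by decide) F₂).of_frame (by decide) F₃
    have h18 : s₃.nvar 18 = a := by rw [F₃.nvar 18 rfl, F₂.nvar 18 rfl, h₁]
    have h19 : s₃.nvar 19 = b := by rw [F₃.nvar 19 rfl, h₂]
  · exact pairExp_fits hd hs₃.toEnv (by rw [h19]; exact hb') (by rw [h18]; exact ha')
  · exact pairExp_fits hd hs₃.toEnv (by rw [h19]; exact hb') (by rw [h18]; exact ha')
  · intro u hu v hv
    simp only [pairExp_eval hs₃.toEnv, NExp.eval, h18, h19, h₃, hs₃.A, Function.update_self,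
      Function.update_apply, pair_inj hv ha', pair_inj hv hb', Finset.mem_insert, entryEdge,
      Sym2.eq_iff, ← ha, ← hb, hE u hu v hv]
    by_cases h1 : u = b ∧ v = a
    · simp [h1]
    · by_cases h2 : u = a ∧ v = b
      · simp only [h2, and_self, true_or, if_true]
        split_ifs with h3
        · rw [h3.1]
        · rfl
      · simp [h1, h2]

lemma iUnion_marks_succ (E : Finset (Sym2 ℕ)) (f : ℕ → Finset (Sym2 ℕ)) (i : ℕ) :
    E ∪ (Finset.range (i + 1)).biUnion f = (E ∪ (Finset.range i).biUnion f) ∪ f i := by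
  rw [Finset.range_add_one, Finset.biUnion_insert, Finset.union_comm (f i), Finset.union_assoc]

/-- Loops collect marks. -/
lemma Halts.forLoop_marked {x y : ℕ} {p : Prog} {s : State} {N T : ℕ} (E : Finset (Sym2 ℕ))
    (f : ℕ → Finset (Sym2 ℕ)) (hE : Marked d E s)
    (hN : s.nvar y = N) (hNW : N < W) (hxy : (x == y) = false) (hx : p.setsN x = false)
    (hy : p.setsN y = false)
    (step : ∀ i < N, ∀ E', ∀ s', Frame (RealRAM.forLoop x y p) s s' → s'.nvar x = i → Marked d E' s' →
      Halts W p s' T (Marked d (E' ∪ f i))) :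
    Halts W (RealRAM.forLoop x y p) s (N * (T + 8) + 6)
      (Marked d (E ∪ (Finset.range N).biUnion f)) := by
  refine Halts.forLoop (fun i s' => Marked d (E ∪ (Finset.range i).biUnion f) s') hN hNW hxy hx hy
    (by simp only [Finset.range_zero, Finset.biUnion_empty, Finset.union_empty]; exact hE)
    fun i hi s' F hxi hI => ?_
  rw [iUnion_marks_succ]
  exact step i hi _ s' F hxi hI

/-- Mark the edge towards the source in variable `7` in the shortest path tree,
for the vertex in variable `8`. -/
def treeProg : Prog :=
  .seq (.nset 20 (indexExp (.var 7) (.var 4) (.lit 0) (.var 8)))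
  (.seq (.nset 21 (.lit 0))
  (.seq (forLoop 22 4 (.ite (.rle (.get 1 (indexExp (.var 7) (.var 22) (.lit 0) (.var 8)))
      (.get 1 (.var 20))) .skip (.nset 21 (.add (.var 22) (.lit 1)))))
  (.seq (.nset 16 (indexExp (.var 7) (.var 21) (.lit 0) (.var 8)))
  markProg)))

/-- The loop follows the recursion of `settle`: variable `21` holds one plus the last hop bound
whose entry exceeds the final one, or `0`. -/
lemma treeProg_halts (hd : d.Valid W) {s : State} (hs : TableEnv d D P s) {E : Finset (Sym2 ℕ)}
    (hE : Marked d E s) (h7 : s.nvar 7 < d.n) (h8 : s.nvar 8 < d.n) :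
    Halts W treeProg s (2 * d.n * 34 + 80) (Marked d (insert (entryEdge d.n P
      (tableIndex d.n d.k (s.nvar 7) (IsTable.settleHop d.n d.k D (s.nvar 7) (s.nvar 8)) 0
        (s.nvar 8))) E)) := by
  have hsz := hd.size_lt
  have hns := hd.hops_lt_size
  have h2k : 0 < 2 ^ d.k := by positivity
  set f : ℕ → ℝ := fun h => D (tableIndex d.n d.k (s.nvar 7) h 0 (s.nvar 8)) with hf
  set c : ℝ := D (tableIndex d.n d.k (s.nvar 7) (2 * d.n) 0 (s.nvar 8)) with hc
  refine Halts.mono (Halts.seq (Halts.nset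
      (Q := fun s' => s'.nvar 20 = tableIndex d.n d.k (s.nvar 7) (2 * d.n) 0 (s.nvar 8))
      (indexExp_fits hd hs.toEnv trivial trivial (Nat.zero_le _) trivial h7 hs.hops.le h2k h8)
      (by simp [indexExp_eval hs.toEnv, NExp.eval, hs.hops]))
    fun s₁ F₁ h₁ => Halts.seq (Halts.nset (Q := fun s' => s'.nvar 21 = 0) (Nat.zero_le _)
      (by simp [NExp.eval]))
    fun s₂ F₂ h₂ => Halts.seq (Halts.forLoop (N := 2 * d.n) (T := 26)
      (fun i s' => s'.nvar 21 = settle f c i) ?_ (by omega) rfl rfl rfl ?_ ?_)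
    fun s₃ F₃ h₃ => Halts.seq (Halts.nset (Q := fun s' => s'.nvar 16 =
      tableIndex d.n d.k (s.nvar 7) (settle f c (2 * d.n)) 0 (s.nvar 8)) ?_ ?_)
    fun s₄ F₄ h₄ => (markProg_halts hd ((((hs.of_frame (by decide) F₁).of_frame (by decide)
      F₂).of_frame (by decide) F₃).of_frame (by decide) F₄) (E := E) ?_).conseq ?_)
    (T' := 2 * d.n * 34 + 80)
    (by simp only [indexExp, cellExp, NExp.cost]; omega)
  · rw [F₂.nvar 4 rfl, F₁.nvar 4 rfl, hs.hops]
  · simpa [settle] using h₂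
  · intro i hi s₃ F₃ h22 h21
    have hs₃ := ((hs.of_frame (by decide) F₁).of_frame (by decide) F₂).of_frame (by decide) F₃
    have h7' : s₃.nvar 7 = s.nvar 7 := by rw [F₃.nvar 7 rfl, F₂.nvar 7 rfl, F₁.nvar 7 rfl]
    have h8' : s₃.nvar 8 = s.nvar 8 := by rw [F₃.nvar 8 rfl, F₂.nvar 8 rfl, F₁.nvar 8 rfl]
    have h20 : s₃.nvar 20 = tableIndex d.n d.k (s.nvar 7) (2 * d.n) 0 (s.nvar 8) := by
      rw [F₃.nvar 20 rfl, F₂.nvar 20 rfl, h₁]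
    refine (Halts.ite (T := 4) ?_ ?_ ?_).mono
      (by simp [BExp.cost, RExp.cost, NExp.cost, indexExp, cellExp])
    · refine ⟨?_, trivial⟩
      exact indexExp_fits hd hs₃.toEnv trivial trivial (Nat.zero_le _) trivial
        (by simpa only [NExp.eval, h7']) (by simp only [NExp.eval, h22]; omega) h2k
        (by simpa only [NExp.eval, h8'])
    · intro ht
      simp only [BExp.eval, RExp.eval, indexExp_eval hs₃.toEnv, NExp.eval, hs₃.D, h7', h8', h20,
        h22] at ht
      refine (Halts.skip ?_).mono (by norm_num)
      simp [settle, h21, hf, hc, ht]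
    · intro ht
      simp only [BExp.eval, RExp.eval, indexExp_eval hs₃.toEnv, NExp.eval, hs₃.D, h7', h8', h20,
        h22] at ht
      refine Halts.nset ?_ ?_
      · simp only [NExp.Fits, NExp.eval, h22, true_and]; omega
      · simp [settle, NExp.eval, h22, hf, hc, ht]
  · have hs₃ := ((hs.of_frame (by decide) F₁).of_frame (by decide) F₂).of_frame (by decide) F₃
    refine indexExp_fits hd hs₃.toEnv trivial trivial (Nat.zero_le _) trivial ?_ ?_ h2k ?_
    · simpa only [NExp.eval, F₃.nvar 7 rfl, F₂.nvar 7 rfl, F₁.nvar 7 rfl]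
    · simp only [NExp.eval, h₃]; exact settle_le _ _ _
    · simpa only [NExp.eval, F₃.nvar 8 rfl, F₂.nvar 8 rfl, F₁.nvar 8 rfl]
  · have hs₃ := ((hs.of_frame (by decide) F₁).of_frame (by decide) F₂).of_frame (by decide) F₃
    simp [indexExp_eval hs₃.toEnv, NExp.eval, h₃, F₃.nvar 7 rfl, F₂.nvar 7 rfl, F₁.nvar 7 rfl,
      F₃.nvar 8 rfl, F₂.nvar 8 rfl, F₁.nvar 8 rfl]
  · intro u hu v hv
    rw [F₄.narr 2 rfl, F₃.narr 2 rfl, F₂.narr 2 rfl, F₁.narr 2 rfl]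
    exact hE u hu v hv
  · rintro s₅ - h₅
    rwa [h₄] at h₅

/-- Mark the path described by the pointers from the final entry for the source in variable `7`,
the full mask and the vertex in variable `8`. -/
def walkProg : Prog :=
  .seq (.nset 16 fullExp) (forLoop 22 4 (.seq markProg (.nset 16 (.get 3 (.var 16)))))

/-- The edge is marked before the pointer advances, so the marks come from the iterates `0` to `2 n
- 1`, as in `walkMarks`. -/
lemma walkProg_halts (hd : d.Valid W) {s : State} (hs : TableEnv d D P s) {E : Finset (Sym2 ℕ)}
    (hE : Marked d E s) (h7 : s.nvar 7 < d.n) (h8 : s.nvar 8 < d.n) :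
    Halts W walkProg s (2 * d.n * 44 + 22)
      (Marked d (E ∪ walkMarks d.n d.k P (s.nvar 7) (s.nvar 8))) := by
  have hsz := hd.size_lt
  have hns := hd.hops_lt_size
  set x := tableIndex d.n d.k (s.nvar 7) (2 * d.n) (2 ^ d.k - 1) (s.nvar 8) with hx
  refine Halts.mono (Halts.seq (Halts.nset (Q := fun s' => s'.nvar 16 = x)
      (fullExp_fits hd hs.toEnv h7 h8) (by simp [fullExp_eval hs.toEnv, hx]))
    fun s₁ F₁ h₁ => (Halts.forLoop (N := 2 * d.n) (T := 36)
      (fun i s' => s'.nvar 16 = P^[i] x ∧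
        Marked d (E ∪ (Finset.range i).image fun i => entryEdge d.n P (P^[i] x)) s')
      ?_ (by omega) rfl rfl rfl ?_ ?_).conseq fun s₂ _ h => h.2)
    (T' := 2 * d.n * 44 + 22)
    (by simp only [fullExp, indexExp, cellExp, NExp.cost]; omega)
  · rw [F₁.nvar 4 rfl, hs.hops]
  · refine ⟨by simpa using h₁, fun u hu v hv => ?_⟩
    simpa [F₁.narr 2 rfl] using hE u hu v hv
  · rintro i hi s₂ F₂ - ⟨h16, hM⟩
    have hs₂ := (hs.of_frame (by decide) F₁).of_frame (by decide) F₂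
    refine Halts.seq (markProg_halts hd hs₂ hM) fun s₃ F₃ h₃ => Halts.nset ?_ ?_
    · exact trivial
    refine ⟨?_, ?_⟩
    · simp [NExp.eval, F₃.nvar 16 rfl, h16, (hs₂.of_frame (by decide) F₃).P,
        Function.iterate_succ_apply']
    · rw [h16] at h₃
      rw [Finset.range_add_one, Finset.image_insert, Finset.union_insert]
      exact h₃

/-- Mark the edges of the spanner. -/
def spannerProg : Prog :=
  forLoop 7 0 (.ite (eqTest (.get 4 (.var 7)) (.lit 1))
    (.seq (forLoop 8 0 treeProg)
      (forLoop 8 0 (.ite (eqTest (.get 4 (.var 8)) (.lit 1)) walkProg .skip))) .skip)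

lemma biUnion_filter_eq (n : ℕ) (M : ℕ → ℕ) (f : ℕ → Finset (Sym2 ℕ)) :
    ((Finset.range n).filter (M · = 1)).biUnion f =
      (Finset.range n).biUnion fun q => if M q = 1 then f q else ∅ := by
  ext e
  simp only [Finset.mem_biUnion, Finset.mem_filter]
  refine exists_congr fun q => ?_
  split_ifs with h <;> simp [h]

lemma spannerProg_halts (hd : d.Valid W) {s : State} (hs : TableEnv d D P s)
    (h2 : s.narr 2 = fun _ => 0) :
    Halts W spannerProg s (d.n * (d.n * (2 * d.n * 100 + 200) + 40) + 6)
      (Marked d (netMarks d.n d.k D P ((Finset.range d.n).filter (s.narr 4 · = 1)))) := by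
  have hsz := hd.size_lt
  have hns := hd.hops_lt_size
  set M := s.narr 4 with hMdef
  refine ((Halts.forLoop_marked (d := d) (N := d.n) (T := d.n * (2 * d.n * 100 + 200) + 32) ∅
    (fun p => if M p = 1 then (treeMarks d.n d.k D P p ∪ ((Finset.range d.n).filter
      (M · = 1)).biUnion fun q => walkMarks d.n d.k P p q) else ∅)
    (fun u hu v hv => by simp [h2]) hs.n (by omega) rfl rfl rfl ?_).mono ?_).conseq ?_
  · intro p hp E s₁ F₁ h7 hE
    have hs₁ := hs.of_frame (by decide) F₁
    have hM : s₁.narr 4 = M := F₁.narr 4 rfl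
    refine (Halts.ite (T := d.n * (2 * d.n * 100 + 200) + 12) ?_ ?_ ?_).mono
      (by simp only [eqTest_cost, NExp.cost]; omega)
    · simp only [eqTest_fits, NExp.Fits, true_and]; omega
    · intro ht
      simp only [eqTest_eval, NExp.eval, hM, h7] at ht
      rw [if_pos ht, ← Finset.union_assoc, biUnion_filter_eq]
      refine (Halts.seq (T := d.n * (2 * d.n * 34 + 80 + 8) + 6)
        (T' := d.n * (2 * d.n * 44 + 22 + 11 + 8) + 6)
        (R := Marked d (E ∪ treeMarks d.n d.k D P p)) ?_ fun s₂ F₂ h₂ => ?_).mono (by nlinarith)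
      · rw [treeMarks, ← Finset.biUnion_singleton]
        refine Halts.forLoop_marked E _ hE hs₁.n (by omega) rfl rfl rfl ?_
        intro t ht E' s₂ F₂ h8 hE'
        have h7' : s₂.nvar 7 = p := (F₂.nvar 7 rfl).trans h7
        have h := treeProg_halts hd (hs₁.of_frame (by decide) F₂) hE' (by omega) (by omega)
        rw [h7', h8, Finset.insert_eq, Finset.union_comm] at h
        exact h
      · have hs₂ := hs₁.of_frame (by decide) F₂
        refine Halts.forLoop_marked _ _ h₂ hs₂.n (by omega) rfl rfl rfl ?_
        intro q hq E' s₃ F₃ h8 hE'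
        have h7' : s₃.nvar 7 = p := by rw [F₃.nvar 7 rfl, F₂.nvar 7 rfl, h7]
        have hM' : s₃.narr 4 = M := by rw [F₃.narr 4 rfl, F₂.narr 4 rfl, hM]
        refine (Halts.ite (T := 2 * d.n * 44 + 22) ?_ ?_ ?_).mono
          (by simp only [eqTest_cost, NExp.cost]; omega)
        · simp only [eqTest_fits, NExp.Fits, true_and]; omega
        · intro ht
          simp only [eqTest_eval, NExp.eval, hM', h8] at ht
          rw [if_pos ht]
          have h := walkProg_halts hd (hs₂.of_frame (by decide) F₃) hE' (by omega) (by omega)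
          rw [h7', h8] at h
          exact h
        · intro ht
          simp only [eqTest_eval, NExp.eval, hM', h8] at ht
          rw [if_neg ht, Finset.union_empty]
          exact (Halts.skip hE').mono (by omega)
    · intro ht
      simp only [eqTest_eval, NExp.eval, hM, h7] at ht
      rw [if_neg ht, Finset.union_empty]
      exact (Halts.skip hE).mono (by omega)
  · exact le_rfl
  · rintro s₁ - h₁
    rw [Finset.empty_union, ← biUnion_filter_eq] at h₁
    exact h₁

end RealRAM

namespace RealRAM

open GroupSteiner

/-! #### The constants -/

/-- Compute the global constants. -/
def setupProg : Prog :=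
  .seq (.nset 2 (.lit 1))
  (.seq (forLoop 13 1 (.nset 2 (.add (.var 2) (.var 2))))
  (.seq (.nset 4 (.add (.var 0) (.var 0)))
  (.seq (.nset 3 (.add (.var 4) (.lit 1)))
  (.seq (.nset 5 (.mul (.var 0) (.var 0)))
  (.seq (.nset 6 (.mul (.mul (.mul (.var 0) (.var 3)) (.var 2)) (.var 0)))
  (.seq (.rset 2 (.lit 1))
  (.seq (forLoop 13 5 (.rset 2 (.add (.var 2) (.get 0 (.var 13)))))
  (.seq (.rset 1 (.lit 0))
  (forLoop 13 4 (.rset 1 (.add (.var 1) (.var 2))))))))))))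

/-- `big` is built by adding `1 + ∑ ω` to itself `2 n` times, because the machine cannot turn an
integer variable into a real. -/
lemma setupProg_halts {d : Data} {W : ℕ} (hd : d.Valid W)
    (hbig : d.big = (2 * d.n : ℕ) * (1 + ∑ j ∈ Finset.range (d.n * d.n), d.ω j)) {s : State}
    (h0 : s.nvar 0 = d.n) (h1 : s.nvar 1 = d.k) (hA : s.narr 0 = d.A) (hρ : s.narr 1 = d.ρ)
    (hε : s.rvar 0 = d.ε) (hω : s.rarr 0 = d.ω) :
    Halts W setupProg s (12 * d.k + 13 * (d.n * d.n) + 24 * d.n + 60) (Env d) := by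
  have hsz := hd.size_lt
  have hks := hd.k_lt_size
  have hps := hd.pow_le_size
  have hns := hd.hops_lt_size
  have hqs := hd.sq_le_size
  have hn0 := hd.n_pos
  refine Halts.mono (Halts.seq (Halts.nset (Q := fun s' => s'.nvar 2 = 1)
      (by simp only [NExp.Fits]; omega) (by simp [NExp.eval]))
    fun s₁ F₁ g₁ => Halts.seq (Halts.forLoop (N := d.k) (T := 4) (fun i s' => s'.nvar 2 = 2 ^ i)
      ?_ (by omega) rfl rfl rfl (by simpa using g₁) ?_)
    fun s₂ F₂ g₂ => Halts.seq (Halts.nset (Q := fun s' => s'.nvar 4 = 2 * d.n) ?_ ?_)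
    fun s₃ F₃ g₃ => Halts.seq (Halts.nset (Q := fun s' => s'.nvar 3 = 2 * d.n + 1) ?_ ?_)
    fun s₄ F₄ g₄ => Halts.seq (Halts.nset (Q := fun s' => s'.nvar 5 = d.n * d.n) ?_ ?_)
    fun s₅ F₅ g₅ => Halts.seq (Halts.nset (Q := fun s' => s'.nvar 6 = d.size) ?_ ?_)
    fun s₆ F₆ g₆ => Halts.seq (Halts.rset (Q := fun s' => s'.rvar 2 = 1) ?_ ?_)
    fun s₇ F₇ g₇ => Halts.seq (Halts.forLoop (N := d.n * d.n) (T := 5)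
      (fun i s' => s'.rvar 2 = 1 + ∑ j ∈ Finset.range i, d.ω j)
      ?_ (by omega) rfl rfl rfl (by simpa using g₇) ?_)
    fun s₈ F₈ g₈ => Halts.seq (Halts.rset (Q := fun s' => s'.rvar 1 = 0) ?_ ?_)
    fun s₉ F₉ g₉ => (Halts.forLoop (N := 2 * d.n) (T := 4)
      (fun i s' => s'.rvar 1 = i * (1 + ∑ j ∈ Finset.range (d.n * d.n), d.ω j))
      ?_ (by omega) rfl rfl rfl (by simpa using g₉) ?_).conseq ?_)
    (T' := 12 * d.k + 13 * (d.n * d.n) + 24 * d.n + 60)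
    (by simp only [NExp.cost, RExp.cost]; omega)
  · rw [F₁.nvar 1 rfl, h1]
  · intro i hi s₂ F₂ _ hI
    have hpow : 2 ^ i < 2 ^ d.k := Nat.pow_lt_pow_right (by norm_num) hi
    refine Halts.nset ?_ ?_
    · simp only [NExp.Fits, NExp.eval, hI, true_and]; omega
    · simp [NExp.eval, hI, pow_succ, mul_two]
  · simp only [NExp.Fits, NExp.eval, true_and, F₂.nvar 0 rfl, F₁.nvar 0 rfl, h0]; omega
  · simp [NExp.eval, F₂.nvar 0 rfl, F₁.nvar 0 rfl, h0, two_mul]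
  · simp only [NExp.Fits, NExp.eval, true_and, g₃]; omega
  · simp [NExp.eval, g₃]
  · simp only [NExp.Fits, NExp.eval, true_and, F₄.nvar 0 rfl, F₃.nvar 0 rfl, F₂.nvar 0 rfl,
      F₁.nvar 0 rfl, h0]
    omega
  · simp [NExp.eval, F₄.nvar 0 rfl, F₃.nvar 0 rfl, F₂.nvar 0 rfl, F₁.nvar 0 rfl, h0]
  · have e1 : d.n * (2 * d.n + 1) ≤ d.n * (2 * d.n + 1) * 2 ^ d.k :=
      Nat.le_mul_of_pos_right _ (by positivity)
    have e2 : d.n * (2 * d.n + 1) * 2 ^ d.k ≤ d.size := Nat.le_mul_of_pos_right _ hn0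
    have e3 : d.n * (2 * d.n + 1) * 2 ^ d.k * d.n = d.size := rfl
    simp only [NExp.Fits, NExp.eval, true_and, F₅.nvar 0 rfl, F₄.nvar 0 rfl, F₃.nvar 0 rfl,
      F₂.nvar 0 rfl, F₁.nvar 0 rfl, h0, F₅.nvar 3 rfl, g₄, F₅.nvar 2 rfl, F₄.nvar 2 rfl,
      F₃.nvar 2 rfl, g₂]
    omega
  · simp [NExp.eval, F₅.nvar 0 rfl, F₄.nvar 0 rfl, F₃.nvar 0 rfl,
      F₂.nvar 0 rfl, F₁.nvar 0 rfl, h0, F₅.nvar 3 rfl, g₄, F₅.nvar 2 rfl, F₄.nvar 2 rfl,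
      F₃.nvar 2 rfl, g₂, Data.size]
  · exact trivial
  · simp [RExp.eval]
  · rw [F₇.nvar 5 rfl, F₆.nvar 5 rfl, g₅]
  · intro i hi s₈ F₈ h13 hI
    have hω' : s₈.rarr 0 = d.ω := by
      rw [F₈.rarr 0 rfl, F₇.rarr 0 rfl, F₆.rarr 0 rfl, F₅.rarr 0 rfl, F₄.rarr 0 rfl, F₃.rarr 0 rfl,
        F₂.rarr 0 rfl, F₁.rarr 0 rfl, hω]
    refine Halts.rset ?_ ?_
    · exact ⟨trivial, trivial⟩
    · simp [RExp.eval, NExp.eval, hI, hω', h13, Finset.sum_range_succ, add_assoc]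
  · exact trivial
  · simp [RExp.eval]
  · rw [F₉.nvar 4 rfl, F₈.nvar 4 rfl, F₇.nvar 4 rfl, F₆.nvar 4 rfl, F₅.nvar 4 rfl, F₄.nvar 4 rfl, g₃]
  · intro i hi s' F' h13 hI
    refine Halts.rset ?_ ?_
    · exact ⟨trivial, trivial⟩
    · simp [RExp.eval, hI, F'.rvar 2 rfl, F₉.rvar 2 rfl, g₈]
      ring
  · intro s' F' hI
    exact
      { n := by rw [F'.nvar 0 rfl, F₉.nvar 0 rfl, F₈.nvar 0 rfl, F₇.nvar 0 rfl, F₆.nvar 0 rfl,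
          F₅.nvar 0 rfl, F₄.nvar 0 rfl, F₃.nvar 0 rfl, F₂.nvar 0 rfl, F₁.nvar 0 rfl, h0]
        k := by rw [F'.nvar 1 rfl, F₉.nvar 1 rfl, F₈.nvar 1 rfl, F₇.nvar 1 rfl, F₆.nvar 1 rfl,
          F₅.nvar 1 rfl, F₄.nvar 1 rfl, F₃.nvar 1 rfl, F₂.nvar 1 rfl, F₁.nvar 1 rfl, h1]
        K := by rw [F'.nvar 2 rfl, F₉.nvar 2 rfl, F₈.nvar 2 rfl, F₇.nvar 2 rfl, F₆.nvar 2 rfl,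
          F₅.nvar 2 rfl, F₄.nvar 2 rfl, F₃.nvar 2 rfl, g₂]
        layers := by rw [F'.nvar 3 rfl, F₉.nvar 3 rfl, F₈.nvar 3 rfl, F₇.nvar 3 rfl, F₆.nvar 3 rfl,
          F₅.nvar 3 rfl, g₄]
        hops := by rw [F'.nvar 4 rfl, F₉.nvar 4 rfl, F₈.nvar 4 rfl, F₇.nvar 4 rfl, F₆.nvar 4 rfl,
          F₅.nvar 4 rfl, F₄.nvar 4 rfl, g₃]
        sq := by rw [F'.nvar 5 rfl, F₉.nvar 5 rfl, F₈.nvar 5 rfl, F₇.nvar 5 rfl, F₆.nvar 5 rfl, g₅]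
        size := by rw [F'.nvar 6 rfl, F₉.nvar 6 rfl, F₈.nvar 6 rfl, F₇.nvar 6 rfl, g₆]
        A := by rw [F'.narr 0 rfl, F₉.narr 0 rfl, F₈.narr 0 rfl, F₇.narr 0 rfl, F₆.narr 0 rfl,
          F₅.narr 0 rfl, F₄.narr 0 rfl, F₃.narr 0 rfl, F₂.narr 0 rfl, F₁.narr 0 rfl, hA]
        ρ := by rw [F'.narr 1 rfl, F₉.narr 1 rfl, F₈.narr 1 rfl, F₇.narr 1 rfl, F₆.narr 1 rfl,
          F₅.narr 1 rfl, F₄.narr 1 rfl, F₃.narr 1 rfl, F₂.narr 1 rfl, F₁.narr 1 rfl, hρ]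
        ε := by rw [F'.rvar 0 rfl, F₉.rvar 0 rfl, F₈.rvar 0 rfl, F₇.rvar 0 rfl, F₆.rvar 0 rfl,
          F₅.rvar 0 rfl, F₄.rvar 0 rfl, F₃.rvar 0 rfl, F₂.rvar 0 rfl, F₁.rvar 0 rfl, hε]
        big := by rw [hI, hbig]
        ω := by rw [F'.rarr 0 rfl, F₉.rarr 0 rfl, F₈.rarr 0 rfl, F₇.rarr 0 rfl, F₆.rarr 0 rfl,
          F₅.rarr 0 rfl, F₄.rarr 0 rfl, F₃.rarr 0 rfl, F₂.rarr 0 rfl, F₁.rarr 0 rfl, hω] }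

/-! #### The instance given by a weighted graph -/

variable {n k : ℕ}

/-- The data of a weighted graph with terminals. -/
noncomputable def graphData (G : SimpleGraph (Fin n)) (w : Sym2 (Fin n) → ℝ≥0) (r : Fin k → Fin n)
    (ε : ℝ) : Data where
  n := n
  k := k
  A := adjEntry G
  ρ := (input G w r ε).narr 1
  ω := weightEntry G w
  ε := ε
  big := (2 * n : ℕ) * (1 + ∑ j ∈ Finset.range (n * n), weightEntry G w j)

lemma input_terminal (G : SimpleGraph (Fin n)) (w : Sym2 (Fin n) → ℝ≥0) (r : Fin k → Fin n)
    (ε : ℝ) (i : Fin k) : (input G w r ε).narr 1 i = r i := by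
  simp [input]

lemma adjEntry_eq (G : SimpleGraph (Fin n)) [DecidableRel G.Adj] (u v : Fin n) :
    adjEntry G (v + n * u) = if G.Adj u v then 1 else 0 := by
  have h : (v : ℕ) + n * u < n * n := (finProdFinEquiv (u, v)).isLt
  have h1 : finProdFinEquiv.symm ⟨(v : ℕ) + n * u, h⟩ = (u, v) :=
    (Equiv.symm_apply_eq _).2 rfl
  rw [adjEntry, dif_pos h, h1]
  congr

lemma adjEntry_eq_one_iff (G : SimpleGraph (Fin n)) (u v : Fin n) :
    adjEntry G (v + n * u) = 1 ↔ G.Adj u v := by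
  classical
  simp [adjEntry_eq]

variable {G : SimpleGraph (Fin n)} {w : Sym2 (Fin n) → ℝ≥0} {r : Fin k → Fin n} {ε : ℝ}

lemma graphData_valid (hn : 0 < n) (hk : 0 < k) {W : ℕ}
    (hW : 4 * (n * (2 * n + 1) * 2 ^ k * n) + 8 < W) : (graphData G w r ε).Valid W where
  n_pos := hn
  k_pos := hk
  ρ_lt i hi := by
    have := input_terminal G w r ε ⟨i, hi⟩
    change (input G w r ε).narr 1 i < n
    simp only at this
    rw [this]
    exact Fin.isLt _
  ω_self v hv := IsTable.weightEntry_self G w ⟨v, hv⟩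
  size_lt := hW

/-- Each edge weighs at most the sum `S` of all matrix entries, so `2 n` edges cost at most `2 n S <
2 n (1 + S)`. -/
lemma walkLength_lt_big (hn : 0 < n) (u v : Fin n) (p : G.Walk u v) (hp : p.length ≤ 2 * n) :
    (walkLength w p : ℝ) < (graphData G w r ε).big := by
  set S := ∑ j ∈ Finset.range (n * n), weightEntry G w j with hS
  have hS0 : 0 ≤ S := Finset.sum_nonneg fun j _ => weightEntry_nonneg G w j
  have h1 : (walkLength w p : ℝ) ≤ p.length * S := by
    clear hp
    induction p with
    | nil => simp
    | @cons a b c h p ih =>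
      have h2 : (w s(a, b) : ℝ) ≤ S := by
        rw [← IsTable.weightEntry_adj h]
        exact Finset.single_le_sum (f := weightEntry G w) (fun j _ => weightEntry_nonneg G w j)
          (Finset.mem_range.2 (finProdFinEquiv (a, b)).isLt)
      rw [walkLength_cons, SimpleGraph.Walk.length_cons]
      push_cast
      linarith
  have h2 : (p.length : ℝ) ≤ (2 * n : ℕ) := by exact_mod_cast hp
  have h3 : (0 : ℝ) < (2 * n : ℕ) := by exact_mod_cast (by omega : 0 < 2 * n)
  change _ < (2 * n : ℕ) * (1 + S)
  nlinarith

lemma tableIndex_div (n k s h m : ℕ) {v : ℕ} (hv : v < n) :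
    tableIndex n k s h m v / n = (s * (2 * n + 1) + h) * 2 ^ k + m := by
  rw [tableIndex, mul_comm, Nat.mul_add_div (by omega), Nat.div_eq_of_lt hv, add_zero]

lemma EntryOK.cell {d : Data} {D : ℕ → ℝ} {P : ℕ → ℕ} {s h m v : ℕ} (hm : m < 2 ^ d.k)
    (hv : v < d.n) (H : EntryOK d D P (tableIndex d.n d.k s h m v)) :
    CellOK d D P (tableIndex d.n d.k s h m v) (s * (2 * d.n + 1) + h) m v := by
  unfold EntryOK at H
  rwa [tableIndex_mod _ _ _ _ _ hv, ← Nat.div_div_eq_div_mul, tableIndex_div _ _ _ _ _ hv,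
    Nat.mul_add_mod', Nat.mod_eq_of_lt hm, mul_comm, Nat.mul_add_div (by positivity),
    Nat.div_eq_of_lt hm, add_zero] at H

/-- The layer `s (2 n + 1) + h` with `h ≤ 2 n` is divisible by `2 n + 1` exactly when `h = 0`;
otherwise the layer before it has the same source and hop bound `h - 1`. -/
lemma isTable_of_entryOK {D : ℕ → ℝ} {P : ℕ → ℕ}
    (H : ∀ j < (graphData G w r ε).size, EntryOK (graphData G w r ε) D P j) :
    IsTable G w k (graphData G w r ε).ρ (graphData G w r ε).big D P := by
  set d := graphData G w r ε with hd
  have hcell : ∀ (s v : Fin n) (h m : ℕ), h ≤ 2 * n → m < 2 ^ k →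
      CellOK d D P (tableIndex n k s h m v) (s * (2 * n + 1) + h) m v := fun s v h m hh hm =>
    (H _ (d.tableIndex_lt s.isLt hh hm v.isLt)).cell hm v.isLt
  have hadj : ∀ u v : Fin n, ((u : ℕ) = v ∨ d.A (v + n * u) = 1) ↔ (u = v ∨ G.Adj u v) := by
    intro u v
    rw [Fin.ext_iff, ← adjEntry_eq_one_iff]; rfl
  have hmod : ∀ s h, h < 2 * n → (s * (2 * n + 1) + (h + 1)) % (2 * d.n + 1) ≠ 0 := fun s h hh => by
    change _ % (2 * n + 1) ≠ 0
    rw [Nat.mul_add_mod', Nat.mod_eq_of_lt (by omega)]; omega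
  refine ⟨fun s v m hm => ?_, fun s v h hh m hm => ?_, fun s v h hh m hm u hu => ?_⟩
  · have h1 := hcell s v 0 m (by omega) hm
    unfold CellOK at h1
    change if (s * (2 * n + 1) + 0) % (2 * n + 1) = 0 then _ else _ at h1
    rw [if_pos (by simp)] at h1
    rw [h1]
    change (if clearMask d.ρ v m k = 0 ∧ (v : ℕ) = (s * (2 * n + 1) + 0) / (2 * n + 1) then _ else _)
      = _
    rw [add_zero, Nat.mul_div_cancel _ (by omega)]
    simp only [Fin.ext_iff]
  · have h1 := hcell s v (h + 1) m (by omega) hm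
    unfold CellOK at h1
    rw [if_neg (hmod s h hh)] at h1
    obtain ⟨⟨u, hu, h2, h3, h4⟩, -⟩ := h1
    exact ⟨⟨u, hu⟩, (hadj ⟨u, hu⟩ v).1 h2, h3, h4⟩
  · have h1 := hcell s v (h + 1) m (by omega) hm
    unfold CellOK at h1
    rw [if_neg (hmod s h hh)] at h1
    exact h1.2 u u.isLt ((hadj u v).2 hu)

/-! ### The whole algorithm and its step count -/

/-- The spanner algorithm. -/
def algorithm : Prog :=
  .seq setupProg (.seq fillProg (.seq minProg (.seq netProg spannerProg)))

/-- With `n, k, K ≥ 1` every monomial is at most `K k n ^ 4`; the leading one comes from filling the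
table. The second inequality allows the time bound to serve as the largest word as well. -/
lemma time_bound {n k K : ℕ} (hn : 0 < n) (hk : 0 < k) (hK : 0 < K) :
    12 * k + 13 * (n * n) + 24 * n + 60 + (n * (2 * n + 1) * K * n * (210 * (k * n) + 8) + 6 +
      (n * (n * 43 + 6 + 8) + 8 + (k * (n * 48 + 24 + 8) + 6 +
        (n * (n * (2 * n * 100 + 200) + 40) + 6)))) ≤ 3000 * (K * k * n ^ 4) ∧
      4 * (n * (2 * n + 1) * K * n) + 8 < 3000 * (K * k * n ^ 4) := by
  have key : ∀ a b c, a ≤ 1 → b ≤ 1 → c ≤ 4 → K ^ a * k ^ b * n ^ c ≤ K * k * n ^ 4 := by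
    intro a b c ha hb hc
    refine Nat.mul_le_mul (Nat.mul_le_mul ?_ ?_) (Nat.pow_le_pow_right hn hc)
    · simpa using Nat.pow_le_pow_right hK ha
    · simpa using Nat.pow_le_pow_right hk hb
  have e0 := key 0 0 0 (by norm_num) (by norm_num) (by norm_num)
  have e1 := key 0 0 1 (by norm_num) (by norm_num) (by norm_num)
  have e2 := key 0 0 2 (by norm_num) (by norm_num) (by norm_num)
  have e3 := key 0 0 3 (by norm_num) (by norm_num) (by norm_num)
  have e4 := key 0 1 0 (by norm_num) (by norm_num) (by norm_num)
  have e5 := key 0 1 1 (by norm_num) (by norm_num) (by norm_num)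
  have e6 := key 1 0 2 (by norm_num) (by norm_num) (by norm_num)
  have e7 := key 1 0 3 (by norm_num) (by norm_num) (by norm_num)
  have e8 := key 1 1 3 (by norm_num) (by norm_num) (by norm_num)
  constructor <;> nlinarith

end RealRAM

theorem mainTheorem1 :
    ∃ (A : RealRAM.Prog) (c d C : ℕ),
      ∀ (n k : ℕ) (_ : 0 < k) (G : SimpleGraph (Fin n)) (_ : G.Connected)
        (w : Sym2 (Fin n) → ℝ≥0) (r : Fin k → Fin n) (ε : ℝ) (_ : 0 < ε) (_ : ε < 1),
        ∃ (T : ℕ) (s : RealRAM.State) (H : SimpleGraph (Fin n)),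
          RealRAM.Exec (c * (2 ^ k * k * n ^ d)) A (RealRAM.input G w r ε) T s ∧
          T ≤ c * (2 ^ k * k * n ^ d) ∧
          RealRAM.IsOutput s H ∧
          GroupSteiner.IsSpanner G H w (fun i : Fin k => ({r i} : Set (Fin n))) (1 + ε) ∧
          (H.edgeSet.ncard : ℝ) ≤ C * (n / ε ^ 2) := by
  refine ⟨RealRAM.algorithm, 3000, 4, 75, fun n k hk G hG w r ε hε hε1 => ?_⟩
  have hn : 0 < n := (r ⟨0, hk⟩).pos
  obtain ⟨hT, hW⟩ := RealRAM.time_bound hn hk (K := 2 ^ k) (by positivity)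
  set W := 3000 * (2 ^ k * k * n ^ 4) with hWdef
  set s₀ := RealRAM.input G w r ε with hs₀
  set d := RealRAM.graphData G w r ε with hddef
  have hd : d.Valid W := RealRAM.graphData_valid hn hk hW
  have hρ : ∀ i : Fin k, d.ρ i = r i := RealRAM.input_terminal G w r ε
  have hbig : ∀ (u v : Fin n) (p : G.Walk u v), p.length ≤ 2 * n →
      (GroupSteiner.walkLength w p : ℝ) < d.big := RealRAM.walkLength_lt_big hn
  have h2k : 0 < 2 ^ k := by positivity
  have hfull : 2 ^ k - 1 < 2 ^ k := by omega
  have key : RealRAM.Halts W RealRAM.algorithm s₀ W fun s => ∃ H : SimpleGraph (Fin n),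
      RealRAM.IsOutput s H ∧
      GroupSteiner.IsSpanner G H w (fun i : Fin k => ({r i} : Set (Fin n))) (1 + ε) ∧
      (H.edgeSet.ncard : ℝ) ≤ 75 * (n / ε ^ 2) := by
    refine RealRAM.Halts.mono (RealRAM.Halts.seq (RealRAM.setupProg_halts hd rfl (by simp [hs₀, RealRAM.input, hddef, RealRAM.graphData])
        (by simp [hs₀, RealRAM.input, hddef, RealRAM.graphData])
        (by simp [hs₀, RealRAM.input, hddef, RealRAM.graphData])
        rfl (by simp [hs₀, RealRAM.input, hddef, RealRAM.graphData])
        (by simp [hs₀, RealRAM.input, hddef, RealRAM.graphData]))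
      fun s₁ F₁ h₁ => RealRAM.Halts.seq (RealRAM.fillProg_halts hd h₁)
      fun s₂ F₂ h₂ => ?_) hT
    have T := RealRAM.isTable_of_entryOK h₂
    have hs₂ : RealRAM.TableEnv d (s₂.rarr 1) (s₂.narr 3) s₂ :=
      ⟨h₁.of_frame (by decide) F₂, rfl, rfl⟩
    refine RealRAM.Halts.seq (RealRAM.minProg_halts hd hs₂) fun s₃ F₃ ⟨hL, hL'⟩ => ?_
    have hs₃ := hs₂.of_frame (by decide) F₃
    replace hL' : ∃ a < n, ∃ b < n, s₃.rvar 3 =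
        s₂.rarr 1 (GroupSteiner.tableIndex n k a (2 * n) (2 ^ k - 1) b) := by
      refine hL'.resolve_left fun h => ?_
      have h5 := hL 0 hn 0 hn
      rw [h] at h5
      exact absurd (GroupSteiner.IsTable.final_lt hbig T hρ hG ⟨0, hn⟩ ⟨0, hn⟩ hfull) (not_lt.2 h5)
    obtain ⟨a, ha, b, hb, hab⟩ := hL'
    have hL0 : 0 ≤ s₃.rvar 3 := by
      obtain ⟨p, hp, -⟩ := GroupSteiner.IsTable.exists_walk_final hbig T hρ hG ⟨a, ha⟩ ⟨b, hb⟩ hfull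
      rw [hab]
      exact hp ▸ NNReal.coe_nonneg _
    have hz : ∀ x, s₀.narr 2 x = 0 ∧ s₀.narr 4 x = 0 := fun x => by simp [hs₀, RealRAM.input]
    have h4 : s₃.narr 4 = fun _ => 0 := by
      rw [F₃.narr 4 rfl, F₂.narr 4 rfl, F₁.narr 4 rfl]
      exact funext fun x => (hz x).2
    refine RealRAM.Halts.seq (RealRAM.netProg_halts hd hs₃ h4 fun i hi => ?_) fun s₄ F₄ h₄ => ?_
    · have h5 := T.final_le_walkLength hρ (.nil : G.Walk (r ⟨i, hi⟩) (r ⟨i, hi⟩)) h2k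
        fun i hi => by simp at hi
      have h6 : d.ρ i = r ⟨i, hi⟩ := hρ ⟨i, hi⟩
      rw [GroupSteiner.walkLength_nil, NNReal.coe_zero] at h5
      have h7 : 0 ≤ ε * s₃.rvar 3 := mul_nonneg hε.le hL0
      rw [h6]
      have h8 : 4 * s₂.rarr 1 (GroupSteiner.tableIndex n k (r ⟨i, hi⟩) (2 * n) 0 (r ⟨i, hi⟩)) ≤ 0 := by
        linarith
      exact h8.trans h7
    have hs₄ := hs₃.of_frame (by decide) F₄
    refine (RealRAM.spannerProg_halts hd hs₄ ?_).conseq fun s₅ F₅ h₅ => ?_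
    · rw [F₄.narr 2 rfl, F₃.narr 2 rfl, F₂.narr 2 rfl, F₁.narr 2 rfl]
      exact funext fun x => (hz x).1
    set N := (Finset.range n).filter (s₄.narr 4 · = 1) with hN
    refine ⟨GroupSteiner.markedGraph G
      (GroupSteiner.netMarks n k (s₂.rarr 1) (s₂.narr 3) N), ?_, ?_⟩
    · intro u v
      classical
      have h6 : s₅.narr 2 (v + n * u) = if s((u : ℕ), (v : ℕ)) ∈
          GroupSteiner.netMarks n k (s₂.rarr 1) (s₂.narr 3) N then
          RealRAM.adjEntry G (v + n * u) else 0 := h₅ u u.isLt v v.isLt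
      rw [h6, RealRAM.adjEntry_eq]
      simp only [GroupSteiner.markedGraph]
      by_cases h7 : G.Adj u v <;>
        by_cases h8 : s((u : ℕ), (v : ℕ)) ∈
          GroupSteiner.netMarks n k (s₂.rarr 1) (s₂.narr 3) N <;> simp [h7, h8]
    · refine GroupSteiner.markedGraph_isSpanner T hρ hk hG hε hε1 hbig
        (fun s t => hL s s.isLt t t.isLt) ⟨⟨a, ha⟩, ⟨b, hb⟩, hab⟩ N (fun x hx => ?_)
        (fun x hx y hy hxy => h₄.sep x (Finset.mem_filter.1 hx).2 y (Finset.mem_filter.1 hy).2 hxy)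
        fun i => ?_
      · obtain ⟨j, hj, rfl⟩ := h₄.terminal x (Finset.mem_filter.1 hx).2
        exact ⟨⟨j, hj⟩, hρ ⟨j, hj⟩⟩
      · obtain ⟨x, hx, h6⟩ := h₄.cover i i.isLt
        rw [hρ i] at h6
        obtain ⟨j, hj, rfl⟩ := h₄.terminal x hx
        exact ⟨d.ρ j, Finset.mem_filter.2 ⟨Finset.mem_range.2 (hd.ρ_lt j hj), hx⟩, h6⟩
  obtain ⟨T, hT', s, hs, H, h1, h2, h3⟩ := key
  exact ⟨T, s, H, hs, hT', h1, h2, by exact_mod_cast h3⟩
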